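/- Let $\mathbb S_n(\mathbb R^g)$ be the space of $g$-tuples of real symmetric $n\times n$ matrices. A non-commutative (nc) set $\mathcal C$ in $g$ variables is a sequence of subsets $\mathcal C(n)\subset\mathbb S_n(\mathbb R^g)$. *Pencils.* A monic affine linear pencil $L(x)=I+A_1x_1+\dots+A_gx_g$ in $g$ variables is given by real symmetric $\ell\times\ell$ matrices $A_1,\dots,A_g$. For $X\in\mathbb S_n(\mathbb R^g)$ put $L(X)=I\otimes I_n+\sum_j A_j\otimes X_j$, and let $\mathcal D_L(n)=\{X\in\mathbb S_n(\mathbb R^g): L(X)\succ 0\}$. *Projection.* If $\mathcal D$ is an nc set in $g+h$ variables, then $\rho[\mathcal D](n)=\{X\in\mathbb S_n(\mathbb R^g): (X,Y)\in\mathcal D(n)\text{ for some }Y\in\mathbb S_n(\mathbb R^h)\}$. *Open matrix convex sets.* An nc set $\mathcal C$ is an open matrix convex set if each $\mathcal C(n)$ is open, convex and contains $0$; if $X\in\mathcal C(m)$ and $Y\in\mathcal C(n)$ imply $X\oplus Y\in\mathcal C(m+n)$; and if $F^TXF=(F^TX_1F,\dots,F^TX_gF)\in\mathcal C(k)$ for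 every $X\in\mathcal C(m)$ and every real $m\times k$ matrix $F$ with operator norm $\|F\|\le 1$. (Boundedness is not required.) An nc set $\mathcal C$ is bounded if there is a constant $K$ such that $\sum_j\|X_j\|\le K$ (operator norms) for all $n$ and all $X\in\mathcal C(n)$. *Semi-algebraic sets.* Let $p$ be a $\delta\times\delta$ matrix of polynomials with real coefficients in non-commuting variables $x_1,\dots,x_g$ that is symmetric, that is, $p^T=p$ for the involution $p=\sum_w p_w w\mapsto\sum_w p_w^T w^T$, where $w^T$ is the word $w$ reversed. Assume that the constant term $p(0)$ is invertible. Let $\mathcal D_p(n)$ be the connected component of $0$ in $\{X\in\mathbb S_n(\mathbb R^g): p(X)\text{ is invertible}\}$, where $p(X)=\sum_w p_w\otimes w(X)$. An nc open semi-algebraic set is a finite union of such nc sets $\mathcal D_p$ (with possibly different sizes $\delta$). **Proposition.** Let $\tilde L$ be a monic affine linear pencil in $g+h$ variables. Then $\rho[\mathcal D_{\tilde L}]$ is an open matrix convex set. Moreover, if $\rho[\mathcal D_{\tilde L}]$ is bounded, then either there is a monic affine linear pencil $L$ in $g$ variables such that $\rho[\mathcal D_{\tilde L}]=\mathcal D_L$,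 or $\rho[\mathcal D_{\tilde L}]$ fails to be nc open semi-algebraic, but not both. -/

import Mathlib

open scoped Matrix Kronecker

namespace FreeConvex

/-- The space of real symmetric `n × n` matrices, as a subspace of all `n × n` matrices. -/
def SymMat (n : ℕ) : Submodule ℝ (Matrix (Fin n) (Fin n) ℝ) where
  carrier := {A | A.IsSymm}
  add_mem' := fun hA hB => Matrix.IsSymm.add hA hB
  zero_mem' := Matrix.isSymm_zero
  smul_mem' := fun c _ hA => Matrix.IsSymm.smul hA c

/-- `𝕊ₙ(ℝᵍ)`: the space of `g`-tuples of real symmetric `n × n` matrices, with its usual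
topology and vector space structure. -/
abbrev SymTuple (g n : ℕ) : Type := Fin g → SymMat n

/-- A non-commutative (graded) set in `g` variables: for each size `n` a set of `g`-tuples of
symmetric `n × n` matrices. (The size `n = 0` is harmless: there is only one tuple of
`0 × 0` matrices.) -/
abbrev NCSet (g : ℕ) : Type := (n : ℕ) → Set (SymTuple g n)

/-! ### Matrix-valued polynomials in symmetric non-commuting variables -/

/-- `δ × δ` matrices of non-commutative polynomials in `x₁, …, x_g`. The involution of
`FreeAlgebra` reverses words and fixes the variables and the real scalars, so that the
conjugate transpose `pᴴ` below is the involution `pᵀ = ∑ p_wᵀ wᵀ`. -/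
abbrev MatPoly (g δ : ℕ) : Type := Matrix (Fin δ) (Fin δ) (FreeAlgebra ℝ (Fin g))

/-- `p` is symmetric: `pᵀ = p` for the involution on matrix polynomials. -/
def MatPoly.IsSymmetric {g δ : ℕ} (p : MatPoly g δ) : Prop := pᴴ = p

/-- The constant term `p(0) = p_∅`, a real `δ × δ` matrix. -/
noncomputable def MatPoly.constTerm {g δ : ℕ} (p : MatPoly g δ) :
    Matrix (Fin δ) (Fin δ) ℝ :=
  p.map (FreeAlgebra.lift ℝ (fun _ : Fin g => (0 : ℝ)))

/-- The value `p(X)`, a `δ × δ` block matrix with `n × n` blocks `p_{ij}(X)`. -/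
noncomputable def MatPoly.eval {g δ n : ℕ} (p : MatPoly g δ) (X : SymTuple g n) :
    Matrix (Fin δ × Fin n) (Fin δ × Fin n) ℝ :=
  Matrix.of fun a b =>
    FreeAlgebra.lift ℝ (fun j => (X j : Matrix (Fin n) (Fin n) ℝ)) (p a.1 b.1) a.2 b.2

/-- The set `{X : p(X) is invertible}`. -/
def invertibleAt {g δ : ℕ} (p : MatPoly g δ) : NCSet g :=
  fun _ => {X | IsUnit (p.eval X)}

/-- The invertibility set `𝒟_p`: at each size, the connected component of `0` in
`{X : p(X) is invertible}`. -/
def invertibilitySet {g δ : ℕ} (p : MatPoly g δ) : NCSet g :=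
  fun n => connectedComponentIn (invertibleAt p n) 0

/-- nc basic open semi-algebraic sets: the sets `𝒟_p` with `p` a symmetric matrix polynomial
such that `p(0)` is invertible. -/
def IsNCBasicOpenSemialgebraic {g : ℕ} (C : NCSet g) : Prop :=
  ∃ δ : ℕ, 0 < δ ∧ ∃ p : MatPoly g δ,
    p.IsSymmetric ∧ IsUnit p.constTerm ∧ C = invertibilitySet p

/-- nc open semi-algebraic sets: finite unions of nc basic open semi-algebraic sets. -/
def IsNCOpenSemialgebraic {g : ℕ} (C : NCSet g) : Prop :=
  ∃ (N : ℕ) (B : Fin N → NCSet g),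
    (∀ j, IsNCBasicOpenSemialgebraic (B j)) ∧ ∀ n, C n = ⋃ j, B j n

/-! ### Monic affine linear pencils -/

/-- A monic affine linear pencil `L(x) = I + A₁ x₁ + ⋯ + A_g x_g` of size `ℓ`, given by its
symmetric `ℓ × ℓ` coefficients `A₁, …, A_g`. -/
structure MonicPencil (g ℓ : ℕ) where
  /-- the coefficients `A₁, …, A_g` -/
  coeff : Fin g → SymMat ℓ

/-- The value `L(X) = I ⊗ Iₙ + A₁ ⊗ X₁ + ⋯ + A_g ⊗ X_g`. -/
noncomputable def MonicPencil.eval {g ℓ n : ℕ} (L : MonicPencil g ℓ) (X : SymTuple g n) :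
    Matrix (Fin ℓ × Fin n) (Fin ℓ × Fin n) ℝ :=
  1 + ∑ j, (L.coeff j : Matrix (Fin ℓ) (Fin ℓ) ℝ) ⊗ₖ (X j : Matrix (Fin n) (Fin n) ℝ)

/-- The positivity set `𝒟_L = {X : L(X) ≻ 0}`, the solution set of a linear matrix
inequality. -/
def MonicPencil.positivitySet {g ℓ : ℕ} (L : MonicPencil g ℓ) : NCSet g :=
  fun _ => {X | (L.eval X).PosDef}

/-! ### Projections and matrix convexity -/

/-- The projection `ρ[D]` of a non-commutative set in `g + h` variables onto the first `g`
coordinates. -/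
def proj {g h : ℕ} (D : NCSet (g + h)) : NCSet g :=
  fun n => {X | ∃ Y : SymTuple h n, Fin.append X Y ∈ D n}

/-- The direct sum `X ⊕ Y` of tuples of symmetric matrices. -/
def directSum {g m n : ℕ} (X : SymTuple g m) (Y : SymTuple g n) : SymTuple g (m + n) :=
  fun j => ⟨Matrix.reindex finSumFinEquiv finSumFinEquiv
      (Matrix.fromBlocks (X j : Matrix (Fin m) (Fin m) ℝ) 0 0 (Y j : Matrix (Fin n) (Fin n) ℝ)),
    (Matrix.IsSymm.fromBlocks (X j).2 Matrix.transpose_zero (Y j).2).submatrix _⟩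

/-- The simultaneous conjugation `Fᵀ X F = (Fᵀ X₁ F, …, Fᵀ X_g F)`. -/
def conj {g m k : ℕ} (F : Matrix (Fin m) (Fin k) ℝ) (X : SymTuple g m) : SymTuple g k :=
  fun j => ⟨Fᵀ * (X j : Matrix (Fin m) (Fin m) ℝ) * F, by
    have h : (X j : Matrix (Fin m) (Fin m) ℝ)ᵀ = X j := (X j).2
    change (Fᵀ * (X j : Matrix (Fin m) (Fin m) ℝ) * F)ᵀ = _
    rw [Matrix.transpose_mul, Matrix.transpose_mul, h, Matrix.transpose_transpose,
      Matrix.mul_assoc]⟩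

section OperatorNorm

open scoped Matrix.Norms.L2Operator

/-- `F` is a contraction: its operator norm for the Euclidean norms is at most `1`. -/
def IsContraction {m k : ℕ} (F : Matrix (Fin m) (Fin k) ℝ) : Prop := ‖F‖ ≤ 1

/-- `C` is bounded: there is one constant `K`, for all sizes, with `∑ ‖X_j‖ ≤ K` (operator
norms) for every `X ∈ C`. -/
def IsNormBounded {g : ℕ} (C : NCSet g) : Prop :=
  ∃ K : ℝ, ∀ n, ∀ X ∈ C n, ∑ j, ‖(X j : Matrix (Fin n) (Fin n) ℝ)‖ ≤ K

end OperatorNorm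

/-- Open matrix convex sets (not required to be bounded). -/
structure IsOpenMatrixConvex {g : ℕ} (C : NCSet g) : Prop where
  isOpen : ∀ n, IsOpen (C n)
  zero_mem : ∀ n, (0 : SymTuple g n) ∈ C n
  directSum_mem : ∀ m n, ∀ X ∈ C m, ∀ Y ∈ C n, directSum X Y ∈ C (m + n)
  conj_mem : ∀ m k, ∀ F : Matrix (Fin m) (Fin k) ℝ, IsContraction F →
    ∀ X ∈ C m, conj F X ∈ C k
  convex : ∀ n, Convex ℝ (C n)

end FreeConvex

namespace FreeConvex

open Matrix

variable {g h ℓ m n k δ d : ℕ}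

/-! ### The quadratic form of a pencil -/

/-! Positivity of `L(X)` survives direct sums, contractive conjugation and convex combinations, and
these act on the kept and the discarded variables at once, so projections of positivity sets are
open matrix convex. A positivity set is semi-algebraic, because definiteness can only be lost
through a singular `L(X)` (`MonicPencil.positivitySet_eq_invertibilitySet`); hence the two
alternatives exclude each other. It remains to see that an open matrix convex semi-algebraic set `C`
is a positivity set.

A finite union collapses to one piece: if every `p_j` were singular somewhere on `C`, the direct sum
of such points would lie in `C` but in no piece (`IsOpenMatrixConvex.isNCBasicOpenSemialgebraic`).
So `C = 𝒟_p`.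

Let `p(X) v = 0` at a boundary point `X`, with `p` of degree at most `d`. Compressing `X` to the
span of the vectors `q(X) v`, `deg q ≤ d`, keeps `p` singular, so the compression lies outside `C`.
Effros–Winkler separation (`IsOpenMatrixConvex.exists_separating_pencil`) gives a pencil `L`,
nonnegative on `C` and singular at the compression. It is then singular at `X`, with a kernel vector
of the form `q(X) v` (`IsBoundaryPair.exists_pencil`).

Finitely many such pencils suffice. Direct sums provide a pair `(X, v)` whose annihilator in degree
`d + 1` is contained in that of every other pair, so `(L q)(X) v = 0` transfers to `(L q)(Y) w = 0`.
Either `L` is singular at `Y`, or `q(Y) w = 0`; the second case imposes new relations, which can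
happen only finitely often. The direct sum of the pencils is singular at all boundary pairs
(`exists_pencil_of_annihilator`), so its positivity set cannot leave `C`. -/

@[ext]
theorem SymTuple.ext' {X Y : SymTuple g n}
    (hXY : ∀ j, (X j : Matrix (Fin n) (Fin n) ℝ) = Y j) : X = Y :=
  funext fun j => Subtype.ext (hXY j)

theorem SymTuple.transpose_coe (X : SymTuple g n) (j : Fin g) :
    (X j : Matrix (Fin n) (Fin n) ℝ)ᵀ = X j := (X j).2

/-- The Frobenius square `tr (Uᵀ U)`. -/
def sqNorm {ι κ : Type*} [Fintype ι] [Fintype κ] (U : Matrix ι κ ℝ) : ℝ := (Uᵀ * U).trace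

theorem sqNorm_eq_sum {ι κ : Type*} [Fintype ι] [Fintype κ] (U : Matrix ι κ ℝ) :
    sqNorm U = ∑ b, U.col b ⬝ᵥ U.col b := by
  simp [sqNorm, Matrix.trace, Matrix.mul_apply, dotProduct, Matrix.col]

theorem sqNorm_nonneg {ι κ : Type*} [Fintype ι] [Fintype κ] (U : Matrix ι κ ℝ) :
    0 ≤ sqNorm U := by
  rw [sqNorm_eq_sum]
  exact Finset.sum_nonneg fun b _ => Finset.sum_nonneg fun a _ => mul_self_nonneg _

theorem sqNorm_eq_zero {ι κ : Type*} [Fintype ι] [Fintype κ] {U : Matrix ι κ ℝ} :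
    sqNorm U = 0 ↔ U = 0 := by
  have := Matrix.trace_conjTranspose_mul_self_eq_zero_iff (A := U)
  rwa [Matrix.conjTranspose_eq_transpose_of_trivial] at this

theorem sqNorm_pos {ι κ : Type*} [Fintype ι] [Fintype κ] {U : Matrix ι κ ℝ} (hU : U ≠ 0) :
    0 < sqNorm U :=
  lt_of_le_of_ne (sqNorm_nonneg U) fun h => hU (sqNorm_eq_zero.1 h.symm)

/-- The action of `L(X)` on `ℝˡ ⊗ ℝⁿ`, whose elements are written as `n × ℓ` matrices. -/
def MonicPencil.act (L : MonicPencil g ℓ) (X : SymTuple g n) (U : Matrix (Fin n) (Fin ℓ) ℝ) :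
    Matrix (Fin n) (Fin ℓ) ℝ :=
  U + ∑ j, (X j : Matrix (Fin n) (Fin n) ℝ) * U * (L.coeff j : Matrix (Fin ℓ) (Fin ℓ) ℝ)

/-- The linear part of the quadratic form of `L(X)`. -/
def MonicPencil.linForm (L : MonicPencil g ℓ) (X : SymTuple g n)
    (U : Matrix (Fin n) (Fin ℓ) ℝ) : ℝ :=
  ∑ j, (Uᵀ * (X j : Matrix (Fin n) (Fin n) ℝ) * U *
    (L.coeff j : Matrix (Fin ℓ) (Fin ℓ) ℝ)).trace

/-- The quadratic form of `L(X)`. -/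
def MonicPencil.quadForm (L : MonicPencil g ℓ) (X : SymTuple g n)
    (U : Matrix (Fin n) (Fin ℓ) ℝ) : ℝ := sqNorm U + L.linForm X U

theorem MonicPencil.eval_mulVec_vec (L : MonicPencil g ℓ) (X : SymTuple g n)
    (U : Matrix (Fin n) (Fin ℓ) ℝ) : L.eval X *ᵥ vec U = vec (L.act X U) := by
  simp only [MonicPencil.eval, MonicPencil.act, Matrix.add_mulVec, Matrix.one_mulVec,
    Matrix.vec_add, Matrix.vec_sum, Matrix.sum_mulVec, Matrix.kronecker_mulVec_vec,
    SymTuple.transpose_coe]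

theorem MonicPencil.vec_dotProduct_eval (L : MonicPencil g ℓ) (X : SymTuple g n)
    (U : Matrix (Fin n) (Fin ℓ) ℝ) : vec U ⬝ᵥ (L.eval X *ᵥ vec U) = L.quadForm X U := by
  simp only [L.eval_mulVec_vec, Matrix.vec_dotProduct_vec, MonicPencil.act, Matrix.mul_add,
    Matrix.trace_add, Matrix.mul_sum, Matrix.trace_sum, MonicPencil.quadForm,
    MonicPencil.linForm, sqNorm, Matrix.mul_assoc]

theorem MonicPencil.isHermitian_eval (L : MonicPencil g ℓ) (X : SymTuple g n) :
    (L.eval X).IsHermitian := by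
  unfold Matrix.IsHermitian MonicPencil.eval
  rw [Matrix.conjTranspose_eq_transpose_of_trivial, Matrix.transpose_add, Matrix.transpose_one,
    Matrix.transpose_sum]
  congr 1
  refine Finset.sum_congr rfl fun j _ => ?_
  rw [← Matrix.kroneckerMap_transpose, SymTuple.transpose_coe, SymTuple.transpose_coe]

theorem MonicPencil.posDef_eval_iff (L : MonicPencil g ℓ) (X : SymTuple g n) :
    (L.eval X).PosDef ↔ ∀ U, U ≠ 0 → 0 < L.quadForm X U := by
  rw [Matrix.posDef_iff_dotProduct_mulVec]
  refine ⟨fun H U hU => ?_, fun H => ⟨L.isHermitian_eval X, fun x hx => ?_⟩⟩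
  · rw [← L.vec_dotProduct_eval]
    exact H.2 (x := vec U) (by simpa using hU)
  · obtain ⟨U, rfl⟩ := Matrix.vec_bijective.2 x
    simpa [L.vec_dotProduct_eval] using H U (by simpa using hx)

theorem MonicPencil.posSemidef_eval_iff (L : MonicPencil g ℓ) (X : SymTuple g n) :
    (L.eval X).PosSemidef ↔ ∀ U, 0 ≤ L.quadForm X U := by
  rw [Matrix.posSemidef_iff_dotProduct_mulVec]
  refine ⟨fun H U => ?_, fun H => ⟨L.isHermitian_eval X, fun x => ?_⟩⟩
  · rw [← L.vec_dotProduct_eval]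
    exact H.2 (vec U)
  · obtain ⟨U, rfl⟩ := Matrix.vec_bijective.2 x
    simpa [L.vec_dotProduct_eval] using H U

theorem MonicPencil.mem_positivitySet (L : MonicPencil g ℓ) {X : SymTuple g n} :
    X ∈ L.positivitySet n ↔ ∀ U, U ≠ 0 → 0 < L.quadForm X U :=
  L.posDef_eval_iff X

theorem MonicPencil.linForm_add (L : MonicPencil g ℓ) (X Y : SymTuple g n)
    (U : Matrix (Fin n) (Fin ℓ) ℝ) : L.linForm (X + Y) U = L.linForm X U + L.linForm Y U := by
  simp [MonicPencil.linForm, Matrix.mul_add, Matrix.add_mul, Finset.sum_add_distrib]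

theorem MonicPencil.linForm_smul (L : MonicPencil g ℓ) (c : ℝ) (X : SymTuple g n)
    (U : Matrix (Fin n) (Fin ℓ) ℝ) : L.linForm (c • X) U = c * L.linForm X U := by
  simp [MonicPencil.linForm, Finset.mul_sum]

theorem MonicPencil.linForm_conj (L : MonicPencil g ℓ) (F : Matrix (Fin m) (Fin k) ℝ)
    (X : SymTuple g m) (U : Matrix (Fin k) (Fin ℓ) ℝ) :
    L.linForm (conj F X) U = L.linForm X (F * U) := by
  simp [MonicPencil.linForm, conj, Matrix.transpose_mul, Matrix.mul_assoc]

/-- Null vectors of a semidefinite form are kernel vectors. This turns the vanishing of a form into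
linear equations, which polynomials acting on `v` can express. -/
theorem MonicPencil.act_eq_zero_of_quadForm (L : MonicPencil g ℓ) {X : SymTuple g n}
    (hX : ∀ U, 0 ≤ L.quadForm X U) {U : Matrix (Fin n) (Fin ℓ) ℝ} (hU : L.quadForm X U = 0) :
    L.act X U = 0 := by
  have := ((L.posSemidef_eval_iff X).2 hX).dotProduct_mulVec_zero_iff (vec U)
  rw [star_trivial, L.vec_dotProduct_eval, L.eval_mulVec_vec, Matrix.vec_eq_zero_iff] at this
  exact this.1 hU

theorem MonicPencil.quadForm_eq_zero_of_act (L : MonicPencil g ℓ) {X : SymTuple g n}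
    {U : Matrix (Fin n) (Fin ℓ) ℝ} (hU : L.act X U = 0) : L.quadForm X U = 0 := by
  rw [← L.vec_dotProduct_eval, L.eval_mulVec_vec, hU]
  simp

/-! ### Contractions and direct sums -/

section OperatorNorm

open scoped Matrix.Norms.L2Operator

theorem isContraction_iff {F : Matrix (Fin m) (Fin k) ℝ} :
    IsContraction F ↔ ∀ x, (F *ᵥ x) ⬝ᵥ (F *ᵥ x) ≤ x ⬝ᵥ x := by
  have key : ∀ {r : ℕ} (y : Fin r → ℝ), ‖WithLp.toLp 2 y‖ ^ 2 = y ⬝ᵥ y := by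
    intro r y
    rw [EuclideanSpace.real_norm_sq_eq]
    simp [dotProduct, sq]
  constructor
  · intro hF x
    rw [← key, ← key]
    have h1 := Matrix.l2_opNorm_mulVec F (WithLp.toLp 2 x)
    have h2 : ‖F‖ * ‖WithLp.toLp 2 x‖ ≤ ‖WithLp.toLp 2 x‖ :=
      mul_le_of_le_one_left (norm_nonneg _) hF
    exact pow_le_pow_left₀ (norm_nonneg _) (h1.trans h2) 2
  · intro H
    unfold IsContraction
    rw [Matrix.l2_opNorm_def]
    refine ContinuousLinearMap.opNorm_le_bound _ zero_le_one fun x => ?_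
    rw [one_mul]
    refine le_of_sq_le_sq ?_ (norm_nonneg _)
    have := H x.ofLp
    rw [← key, ← key] at this
    exact this

end OperatorNorm

theorem IsContraction.sqNorm_mul_le {F : Matrix (Fin m) (Fin k) ℝ} (hF : IsContraction F)
    (U : Matrix (Fin k) (Fin ℓ) ℝ) : sqNorm (F * U) ≤ sqNorm U := by
  rw [sqNorm_eq_sum, sqNorm_eq_sum]
  exact Finset.sum_le_sum fun b _ => isContraction_iff.1 hF (U.col b)

/-- Block multiplication. A sum of conjugates is one conjugate of a direct sum; this makes the Gram
cone below convex and quadratic forms additive. -/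
theorem conj_stack (F : Matrix (Fin m) (Fin k) ℝ) (G : Matrix (Fin n) (Fin k) ℝ)
    (X : SymTuple g m) (Y : SymTuple g n) :
    conj ((Matrix.fromRows F G).reindex finSumFinEquiv (Equiv.refl _)) (directSum X Y) =
      conj F X + conj G Y := by
  ext1 j
  change ((Matrix.fromRows F G).submatrix finSumFinEquiv.symm id)ᵀ *
    ((Matrix.fromBlocks (X j : Matrix (Fin m) (Fin m) ℝ) 0 0 _).submatrix finSumFinEquiv.symm
      finSumFinEquiv.symm) * ((Matrix.fromRows F G).submatrix finSumFinEquiv.symm id) = _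
  rw [Matrix.transpose_submatrix, Matrix.submatrix_mul_equiv, Matrix.submatrix_mul_equiv,
    Matrix.transpose_fromRows, Matrix.fromCols_mul_fromBlocks, Matrix.fromCols_mul_fromRows]
  simp [conj]

theorem stack_transpose_mul_self (F : Matrix (Fin m) (Fin k) ℝ) (G : Matrix (Fin n) (Fin k) ℝ) :
    ((Matrix.fromRows F G).reindex finSumFinEquiv (Equiv.refl _))ᵀ *
      ((Matrix.fromRows F G).reindex finSumFinEquiv (Equiv.refl _)) = Fᵀ * F + Gᵀ * G := by
  change ((Matrix.fromRows F G).submatrix finSumFinEquiv.symm id)ᵀ *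
    ((Matrix.fromRows F G).submatrix finSumFinEquiv.symm id) = _
  rw [Matrix.transpose_submatrix, Matrix.submatrix_mul_equiv,
    Matrix.transpose_fromRows, Matrix.fromCols_mul_fromRows]
  simp

theorem exists_eq_stack (U : Matrix (Fin (m + n)) (Fin k) ℝ) :
    ∃ F : Matrix (Fin m) (Fin k) ℝ, ∃ G : Matrix (Fin n) (Fin k) ℝ,
      U = (Matrix.fromRows F G).reindex finSumFinEquiv (Equiv.refl _) := by
  refine ⟨U.submatrix (Fin.castAdd n) id, U.submatrix (Fin.natAdd m) id, ?_⟩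
  ext a b
  refine Fin.addCases (fun i => ?_) (fun i => ?_) a <;> simp

theorem MonicPencil.linForm_eq_one (L : MonicPencil g ℓ) (X : SymTuple g n)
    (U : Matrix (Fin n) (Fin ℓ) ℝ) : L.linForm X U = L.linForm (conj U X) 1 := by
  rw [L.linForm_conj, Matrix.mul_one]

theorem MonicPencil.quadForm_directSum (L : MonicPencil g ℓ) (X : SymTuple g m)
    (Y : SymTuple g n) (F : Matrix (Fin m) (Fin ℓ) ℝ) (G : Matrix (Fin n) (Fin ℓ) ℝ) :
    L.quadForm (directSum X Y) ((Matrix.fromRows F G).reindex finSumFinEquiv (Equiv.refl _)) =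
      L.quadForm X F + L.quadForm Y G := by
  unfold MonicPencil.quadForm
  rw [L.linForm_eq_one, conj_stack, L.linForm_add, ← L.linForm_eq_one, ← L.linForm_eq_one,
    sqNorm, stack_transpose_mul_self, Matrix.trace_add]
  simp only [sqNorm]
  ring

/-! ### Positivity sets and projections are open matrix convex -/

/-- By homogeneity only the unit sphere has to be tested, and its compactness makes the condition
open. -/
theorem isOpen_setOf_posForm (ι : Type*) [Fintype ι] :
    IsOpen {A : Matrix ι ι ℝ | ∀ x, x ≠ 0 → 0 < x ⬝ᵥ (A *ᵥ x)} := by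
  have hcont : Continuous fun q : Matrix ι ι ℝ × (ι → ℝ) => q.2 ⬝ᵥ (q.1 *ᵥ q.2) := by
    fun_prop
  have heq : {A : Matrix ι ι ℝ | ∀ x, x ≠ 0 → 0 < x ⬝ᵥ (A *ᵥ x)} =
      {A | ∀ x ∈ Metric.sphere (0 : ι → ℝ) 1, 0 < x ⬝ᵥ (A *ᵥ x)} := by
    ext A
    refine ⟨fun H x hx => H x ?_, fun H x hx => ?_⟩
    · rintro rfl
      simp at hx
    · have hn : 0 < ‖x‖ := norm_pos_iff.2 hx
      have := H (‖x‖⁻¹ • x) (by simp [norm_smul, hn.ne'])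
      rw [Matrix.mulVec_smul, dotProduct_smul, smul_dotProduct, smul_eq_mul, smul_eq_mul] at this
      have hi : 0 < ‖x‖⁻¹ := inv_pos.2 hn
      exact (mul_pos_iff_of_pos_left hi).1 ((mul_pos_iff_of_pos_left hi).1 this)
  rw [heq, isOpen_iff_mem_nhds]
  intro A hA
  refine (isCompact_sphere (0 : ι → ℝ) 1).eventually_forall_of_forall_eventually fun x hx => ?_
  exact (hcont.tendsto (A, x)).eventually (lt_mem_nhds (hA x hx))

theorem MonicPencil.continuous_eval (L : MonicPencil g ℓ) :
    Continuous fun X : SymTuple g n => L.eval X := by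
  refine continuous_matrix fun a b => ?_
  simp only [MonicPencil.eval, Matrix.add_apply, Matrix.sum_apply, Matrix.kroneckerMap_apply]
  refine continuous_const.add (continuous_finsetSum _ fun j _ => continuous_const.mul ?_)
  exact (continuous_subtype_val.comp (continuous_apply j)).matrix_elem _ _

theorem MonicPencil.mem_positivitySet_iff_eval (L : MonicPencil g ℓ) {X : SymTuple g n} :
    X ∈ L.positivitySet n ↔ ∀ x, x ≠ 0 → 0 < x ⬝ᵥ (L.eval X *ᵥ x) := by
  change (L.eval X).PosDef ↔ _
  rw [Matrix.posDef_iff_dotProduct_mulVec]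
  exact ⟨fun H x hx => H.2 hx, fun H => ⟨L.isHermitian_eval X, fun x hx => H x hx⟩⟩

theorem MonicPencil.isOpenMatrixConvex (L : MonicPencil g ℓ) :
    IsOpenMatrixConvex L.positivitySet where
  isOpen n := by
    have := (isOpen_setOf_posForm (Fin ℓ × Fin n)).preimage (L.continuous_eval (n := n))
    convert this using 1
    ext X
    exact L.mem_positivitySet_iff_eval
  zero_mem n := by
    refine L.mem_positivitySet.2 fun U hU => ?_
    have := L.linForm_smul 0 (0 : SymTuple g n) U
    rw [zero_smul, zero_mul] at this
    rw [MonicPencil.quadForm, this, add_zero]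
    exact sqNorm_pos hU
  directSum_mem m n X hX Y hY := by
    refine L.mem_positivitySet.2 fun U hU => ?_
    obtain ⟨F, G, rfl⟩ := exists_eq_stack U
    rw [L.quadForm_directSum]
    have h0 : ∀ {r : ℕ} {Z : SymTuple g r} (_ : Z ∈ L.positivitySet r) (V), 0 ≤ L.quadForm Z V :=
      fun hZ => (L.posSemidef_eval_iff _).1 (Matrix.PosDef.posSemidef hZ)
    by_cases hF : F = 0
    · refine add_pos_of_nonneg_of_pos (h0 hX F) (L.mem_positivitySet.1 hY G ?_)
      rintro rfl
      refine hU ?_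
      subst hF
      ext a b
      refine Fin.addCases (fun i => ?_) (fun i => ?_) a <;> simp
    · exact add_pos_of_pos_of_nonneg (L.mem_positivitySet.1 hX F hF) (h0 hY G)
  conj_mem m k F hF X hX := by
    refine L.mem_positivitySet.2 fun U hU => ?_
    have h1 := hF.sqNorm_mul_le U
    rw [MonicPencil.quadForm, L.linForm_conj]
    by_cases hFU : F * U = 0
    · have : L.linForm X (F * U) = 0 := by simp [hFU, MonicPencil.linForm]
      rw [this, add_zero]
      exact sqNorm_pos hU
    · have := L.mem_positivitySet.1 hX _ hFU
      rw [MonicPencil.quadForm] at this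
      linarith
  convex n := by
    intro X hX Y hY a b ha hb hab
    refine L.mem_positivitySet.2 fun U hU => ?_
    have h1 := L.mem_positivitySet.1 hX U hU
    have h2 := L.mem_positivitySet.1 hY U hU
    have h3 : L.quadForm (a • X + b • Y) U = a * L.quadForm X U + b * L.quadForm Y U := by
      rw [MonicPencil.quadForm, L.linForm_add, L.linForm_smul, L.linForm_smul,
        MonicPencil.quadForm, MonicPencil.quadForm]
      linear_combination (-sqNorm U) * hab
    rw [h3]
    rcases ha.eq_or_lt with rfl | ha
    · have : b = 1 := by linarith
      subst this
      linarith
    · have := mul_pos ha h1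
      have := mul_nonneg hb h2.le
      linarith

theorem append_map {r : ℕ} (f : Fin (g + h) → SymMat n → SymMat r) (X : SymTuple g n)
    (Y : SymTuple h n) :
    Fin.append (fun j => f (Fin.castAdd h j) (X j)) (fun j => f (Fin.natAdd g j) (Y j)) =
      fun j => f j (Fin.append X Y j) := by
  funext j
  refine Fin.addCases (fun i => ?_) (fun i => ?_) j <;> simp

theorem IsOpenMatrixConvex.proj {D : NCSet (g + h)} (hD : IsOpenMatrixConvex D) :
    IsOpenMatrixConvex (proj D) where
  isOpen n := by
    have heq : FreeConvex.proj D n =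
        ⋃ Y : SymTuple h n, (fun X : SymTuple g n => Fin.append X Y) ⁻¹' D n := by
      ext X
      simp [FreeConvex.proj]
    rw [heq]
    refine isOpen_iUnion fun Y => (hD.isOpen n).preimage (continuous_pi fun j => ?_)
    refine Fin.addCases (fun i => ?_) (fun i => ?_) j
    · simpa using continuous_apply i
    · simpa using continuous_const
  zero_mem n := by
    refine ⟨0, ?_⟩
    convert hD.zero_mem n using 1
    exact append_map (n := n) (fun _ _ => 0) 0 0
  directSum_mem m n := by
    rintro X ⟨X', hX⟩ Y ⟨Y', hY⟩
    refine ⟨directSum X' Y', ?_⟩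
    convert hD.directSum_mem m n _ hX _ hY using 1
    funext j
    refine Fin.addCases (fun i => ?_) (fun i => ?_) j <;> simp [directSum]
  conj_mem m k F hF := by
    rintro X ⟨X', hX⟩
    refine ⟨conj F X', ?_⟩
    convert hD.conj_mem m k F hF _ hX using 1
    funext j
    refine Fin.addCases (fun i => ?_) (fun i => ?_) j <;> simp [conj]
  convex n := by
    rintro X ⟨X', hX⟩ Y ⟨Y', hY⟩ a b ha hb hab
    refine ⟨a • X' + b • Y', ?_⟩
    convert hD.convex n hX hY ha hb hab using 1
    funext j
    refine Fin.addCases (fun i => ?_) (fun i => ?_) j <;> simp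

/-! ### Evaluation of polynomials -/

/-- Evaluation of non-commutative polynomials at a tuple of symmetric matrices. -/
noncomputable def evalHom (X : SymTuple g n) :
    FreeAlgebra ℝ (Fin g) →ₐ[ℝ] Matrix (Fin n) (Fin n) ℝ :=
  FreeAlgebra.lift ℝ fun j => (X j : Matrix (Fin n) (Fin n) ℝ)

@[simp]
theorem evalHom_ι (X : SymTuple g n) (j : Fin g) :
    evalHom X (FreeAlgebra.ι ℝ j) = (X j : Matrix (Fin n) (Fin n) ℝ) :=
  FreeAlgebra.lift_ι_apply _ _

/-- For a row `q` of polynomials and a column `v` of vectors, the vector `q(X) v`. -/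
noncomputable def rowEval (X : SymTuple g n) (v : Fin δ → Fin n → ℝ) :
    (Fin δ → FreeAlgebra ℝ (Fin g)) →ₗ[ℝ] (Fin n → ℝ) where
  toFun q := ∑ i, evalHom X (q i) *ᵥ v i
  map_add' q r := by simp [Matrix.add_mulVec, Finset.sum_add_distrib]
  map_smul' c q := by simp [Matrix.smul_mulVec, Finset.smul_sum]

theorem rowEval_apply (X : SymTuple g n) (v : Fin δ → Fin n → ℝ)
    (q : Fin δ → FreeAlgebra ℝ (Fin g)) : rowEval X v q = ∑ i, evalHom X (q i) *ᵥ v i := rfl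

theorem rowEval_mul (X : SymTuple g n) (v : Fin δ → Fin n → ℝ) (s : FreeAlgebra ℝ (Fin g))
    (q : Fin δ → FreeAlgebra ℝ (Fin g)) :
    rowEval X v (fun i => s * q i) = evalHom X s *ᵥ rowEval X v q := by
  simp only [rowEval_apply, map_mul, Matrix.mulVec_sum, Matrix.mulVec_mulVec]

theorem rowEval_single_one (X : SymTuple g n) (v : Fin δ → Fin n → ℝ) (i : Fin δ) :
    rowEval X v (Pi.single i 1) = v i := by
  rw [rowEval_apply, Finset.sum_eq_single i]
  · simp
  · intro j _ hj
    simp [Pi.single_eq_of_ne hj]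
  · simp

theorem MatPoly.eval_apply (p : MatPoly g δ) (X : SymTuple g n) (a b : Fin δ × Fin n) :
    p.eval X a b = evalHom X (p a.1 b.1) a.2 b.2 := rfl

theorem MatPoly.eval_mulVec (p : MatPoly g δ) (X : SymTuple g n) (v : Fin δ → Fin n → ℝ) :
    p.eval X *ᵥ Function.uncurry v = Function.uncurry fun i => rowEval X v (p i) := by
  ext ⟨i, a⟩
  simp only [Matrix.mulVec, dotProduct, Fintype.sum_prod_type, Function.uncurry_apply_pair,
    rowEval_apply, Finset.sum_apply, MatPoly.eval_apply]

theorem MatPoly.not_isUnit_eval_iff (p : MatPoly g δ) (X : SymTuple g n) :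
    ¬ IsUnit (p.eval X) ↔ ∃ v : Fin δ → Fin n → ℝ, v ≠ 0 ∧ ∀ i, rowEval X v (p i) = 0 := by
  rw [Matrix.isUnit_iff_isUnit_det, isUnit_iff_ne_zero, not_not,
    ← Matrix.exists_mulVec_eq_zero_iff]
  constructor
  · rintro ⟨w, hw, h0⟩
    refine ⟨Function.curry w, fun h => hw ?_, fun i => funext fun a => ?_⟩
    · rw [← Function.uncurry_curry w, h]
      rfl
    · have := p.eval_mulVec X (Function.curry w)
      rw [Function.uncurry_curry, h0] at this
      exact (congrFun this (i, a)).symm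
  · rintro ⟨v, hv, h0⟩
    refine ⟨Function.uncurry v, fun h => hv ?_, ?_⟩
    · rw [← Function.curry_uncurry v, h]
      rfl
    · rw [p.eval_mulVec, funext h0]
      rfl

theorem directSum_mulVec_append (X : SymTuple g m) (Y : SymTuple g n) (j : Fin g)
    (u : Fin m → ℝ) (w : Fin n → ℝ) :
    (directSum X Y j : Matrix (Fin (m + n)) (Fin (m + n)) ℝ) *ᵥ Fin.append u w =
      Fin.append ((X j : Matrix (Fin m) (Fin m) ℝ) *ᵥ u)
        ((Y j : Matrix (Fin n) (Fin n) ℝ) *ᵥ w) := by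
  ext a
  refine Fin.addCases (fun i => ?_) (fun i => ?_) a <;>
    simp [directSum, Matrix.mulVec, dotProduct, Fin.sum_univ_add]

theorem append_add (u u' : Fin m → ℝ) (w w' : Fin n → ℝ) :
    Fin.append u w + Fin.append u' w' = Fin.append (u + u') (w + w') := by
  ext a
  refine Fin.addCases (fun i => ?_) (fun i => ?_) a <;> simp

theorem append_eq_zero {u : Fin m → ℝ} {w : Fin n → ℝ} :
    Fin.append u w = 0 ↔ u = 0 ∧ w = 0 := by
  constructor
  · intro h
    exact ⟨funext fun i => by simpa using congrFun h (Fin.castAdd n i),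
      funext fun i => by simpa using congrFun h (Fin.natAdd m i)⟩
  · rintro ⟨rfl, rfl⟩
    ext a
    refine Fin.addCases (fun i => ?_) (fun i => ?_) a <;> simp

theorem evalHom_directSum_mulVec (X : SymTuple g m) (Y : SymTuple g n)
    (q : FreeAlgebra ℝ (Fin g)) (u : Fin m → ℝ) (w : Fin n → ℝ) :
    evalHom (directSum X Y) q *ᵥ Fin.append u w =
      Fin.append (evalHom X q *ᵥ u) (evalHom Y q *ᵥ w) := by
  induction q using FreeAlgebra.induction generalizing u w with
  | grade0 r =>
    rw [AlgHom.commutes, AlgHom.commutes, AlgHom.commutes, Algebra.algebraMap_eq_smul_one,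
      Algebra.algebraMap_eq_smul_one, Algebra.algebraMap_eq_smul_one, Matrix.smul_mulVec,
      Matrix.smul_mulVec, Matrix.smul_mulVec, Matrix.one_mulVec, Matrix.one_mulVec,
      Matrix.one_mulVec]
    ext a
    refine Fin.addCases (fun i => ?_) (fun i => ?_) a <;> simp
  | grade1 j => simpa using directSum_mulVec_append X Y j u w
  | mul a b ha hb => simp only [map_mul, ← Matrix.mulVec_mulVec, ha, hb]
  | add a b ha hb => simp only [map_add, Matrix.add_mulVec, ha, hb, append_add]

theorem rowEval_directSum (X : SymTuple g m) (Y : SymTuple g n) (v : Fin δ → Fin m → ℝ)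
    (w : Fin δ → Fin n → ℝ) (q : Fin δ → FreeAlgebra ℝ (Fin g)) :
    rowEval (directSum X Y) (fun i => Fin.append (v i) (w i)) q =
      Fin.append (rowEval X v q) (rowEval Y w q) := by
  simp only [rowEval_apply, evalHom_directSum_mulVec]
  induction (Finset.univ : Finset (Fin δ)) using Finset.induction_on with
  | empty => simpa using (append_eq_zero.2 ⟨rfl, rfl⟩).symm
  | insert a s ha ih => simp only [Finset.sum_insert ha, ih, append_add]

theorem append_family_ne_zero {v : Fin δ → Fin m → ℝ} {w : Fin δ → Fin n → ℝ}
    (h : v ≠ 0 ∨ w ≠ 0) : (fun i => Fin.append (v i) (w i)) ≠ 0 := by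
  intro h0
  have := fun i => append_eq_zero.1 (congrFun h0 i)
  exact h.elim (fun hv => hv (funext fun i => (this i).1)) fun hw => hw (funext fun i => (this i).2)

/-- A kernel vector at one summand, padded with zeros, is a kernel vector at the direct sum. -/
theorem MatPoly.isUnit_eval_of_directSum (p : MatPoly g δ) {X : SymTuple g m}
    {Y : SymTuple g n} (h : IsUnit (p.eval (directSum X Y))) :
    IsUnit (p.eval X) ∧ IsUnit (p.eval Y) := by
  constructor <;> by_contra h'
  · obtain ⟨v, hv, h0⟩ := (p.not_isUnit_eval_iff X).1 h'
    refine (p.not_isUnit_eval_iff _).2 ⟨fun i => Fin.append (v i) ((0 : Fin δ → Fin n → ℝ) i),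
      append_family_ne_zero (.inl hv), fun i => ?_⟩ h
    rw [rowEval_directSum, h0, append_eq_zero]
    simp [rowEval_apply]
  · obtain ⟨v, hv, h0⟩ := (p.not_isUnit_eval_iff Y).1 h'
    refine (p.not_isUnit_eval_iff _).2 ⟨fun i => Fin.append ((0 : Fin δ → Fin m → ℝ) i) (v i),
      append_family_ne_zero (.inr hv), fun i => ?_⟩ h
    rw [rowEval_directSum, h0, append_eq_zero]
    simp [rowEval_apply]

/-! ### Invertibility sets -/

theorem mem_invertibleAt {p : MatPoly g δ} {X : SymTuple g n} :
    X ∈ invertibleAt p n ↔ IsUnit (p.eval X) := Iff.rfl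

theorem isUnit_eval_of_mem_invertibilitySet {p : MatPoly g δ} {X : SymTuple g n}
    (hX : X ∈ invertibilitySet p n) : IsUnit (p.eval X) :=
  connectedComponentIn_subset (invertibleAt p n) 0 hX

theorem mem_invertibilitySet_of_segment {p : MatPoly g δ} {X : SymTuple g n}
    (hX : ∀ t ∈ Set.Icc (0 : ℝ) 1, IsUnit (p.eval (t • X))) : X ∈ invertibilitySet p n := by
  have hpre : IsPreconnected ((fun t : ℝ => t • X) '' Set.Icc (0 : ℝ) 1) :=
    isPreconnected_Icc.image _ (by fun_prop)
  refine hpre.subset_connectedComponentIn (F := invertibleAt p n) ⟨0, by simp⟩ ?_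
    ⟨1, by simp⟩
  rintro _ ⟨t, ht, rfl⟩
  exact hX t ht

/-- Each `C n` is convex, hence connected, and contains `0`, so it lies in the component of `0`. -/
theorem eq_invertibilitySet_of_isUnit {C : NCSet g} (hC : IsOpenMatrixConvex C)
    {p : MatPoly g δ} (hsub : ∀ n, invertibilitySet p n ⊆ C n)
    (hunit : ∀ n, ∀ X ∈ C n, IsUnit (p.eval X)) : C = invertibilitySet p := by
  funext n
  refine (Set.Subset.antisymm ?_ (hsub n))
  exact (hC.convex n).isPreconnected.subset_connectedComponentIn (hC.zero_mem n)
    fun X hX => hunit n X hX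

/-- A matrix convex set which is a finite union of basic open semi-algebraic sets is one of
them. -/
theorem IsOpenMatrixConvex.isNCBasicOpenSemialgebraic {C : NCSet g}
    (hC : IsOpenMatrixConvex C) (hs : IsNCOpenSemialgebraic C) :
    IsNCBasicOpenSemialgebraic C := by
  obtain ⟨N, B, hB, hCB⟩ := hs
  choose δ hδ p hsymm hunit hBp using hB
  by_contra hbasic
  have hbad : ∀ j, ∃ n, ∃ X ∈ C n, ¬ IsUnit ((p j).eval X) := by
    intro j
    by_contra! hj
    refine hbasic ⟨δ j, hδ j, p j, hsymm j, hunit j, eq_invertibilitySet_of_isUnit hC ?_ hj⟩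
    intro n X hX
    rw [hCB n]
    refine Set.mem_iUnion.2 ⟨j, ?_⟩
    rw [hBp j]
    exact hX
  -- Singularity passes to direct sums, so the bad points can be collected in a single point of `C`.
  have hall : ∀ s : Finset (Fin N), ∃ n, ∃ X ∈ C n, ∀ j ∈ s, ¬ IsUnit ((p j).eval X) := by
    intro s
    induction s using Finset.induction_on with
    | empty => exact ⟨0, 0, hC.zero_mem 0, by simp⟩
    | insert j s hj ih =>
      obtain ⟨n, X, hX, hXs⟩ := ih
      obtain ⟨m, Y, hY, hYj⟩ := hbad j
      refine ⟨n + m, directSum X Y, hC.directSum_mem n m X hX Y hY, fun i hi hu => ?_⟩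
      obtain ⟨h1, h2⟩ := (p i).isUnit_eval_of_directSum hu
      rcases Finset.mem_insert.1 hi with rfl | hi
      · exact hYj h2
      · exact hXs i hi h1
  obtain ⟨n, X, hX, hXs⟩ := hall Finset.univ
  rw [hCB n] at hX
  obtain ⟨j, hj⟩ := Set.mem_iUnion.1 hX
  rw [hBp j] at hj
  exact hXs j (Finset.mem_univ j) (isUnit_eval_of_mem_invertibilitySet hj)

/-! ### Positivity sets are semi-algebraic -/

/-- A pencil as a matrix polynomial. -/
noncomputable def MonicPencil.toMatPoly (L : MonicPencil g ℓ) : MatPoly g ℓ :=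
  Matrix.of fun a b => algebraMap ℝ _ ((1 : Matrix (Fin ℓ) (Fin ℓ) ℝ) a b) +
    ∑ j, algebraMap ℝ _ ((L.coeff j : Matrix (Fin ℓ) (Fin ℓ) ℝ) a b) * FreeAlgebra.ι ℝ j

theorem MonicPencil.isSymmetric_toMatPoly (L : MonicPencil g ℓ) : L.toMatPoly.IsSymmetric := by
  ext a b
  have hA : ∀ j, (L.coeff j : Matrix (Fin ℓ) (Fin ℓ) ℝ) b a =
      (L.coeff j : Matrix (Fin ℓ) (Fin ℓ) ℝ) a b := fun j =>
    congrFun (congrFun (L.coeff j).2 a) b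
  simp only [Matrix.conjTranspose_apply, MonicPencil.toMatPoly, Matrix.of_apply, star_add,
    star_sum, star_mul, FreeAlgebra.star_ι, FreeAlgebra.star_algebraMap, hA]
  rw [← Matrix.transpose_apply (1 : Matrix (Fin ℓ) (Fin ℓ) ℝ), Matrix.transpose_one]
  congr 1
  exact Finset.sum_congr rfl fun j _ => (Algebra.commutes _ _).symm

theorem MonicPencil.constTerm_toMatPoly (L : MonicPencil g ℓ) : L.toMatPoly.constTerm = 1 := by
  ext a b
  simp [MatPoly.constTerm, MonicPencil.toMatPoly]

theorem MonicPencil.eval_toMatPoly (L : MonicPencil g ℓ) (X : SymTuple g n) :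
    L.toMatPoly.eval X = L.eval X := by
  ext ⟨a, a'⟩ ⟨b, b'⟩
  rw [MatPoly.eval_apply]
  simp only [MonicPencil.toMatPoly, Matrix.of_apply, map_add, map_sum, AlgHom.commutes,
    MonicPencil.eval, Matrix.add_apply, Matrix.sum_apply, Matrix.kroneckerMap_apply,
    ← Algebra.smul_def]
  congr 1
  · rw [Algebra.algebraMap_eq_smul_one, Matrix.smul_apply, ← Matrix.one_kronecker_one,
      Matrix.kroneckerMap_apply, smul_eq_mul]
  · exact Finset.sum_congr rfl fun j _ => by
      rw [map_smul, evalHom_ι, Matrix.smul_apply, smul_eq_mul]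

/-- Where `L(X)` is invertible, its form is either positive definite or somewhere negative. These
open conditions are disjoint, so the component of `0` cannot cross between them. -/
theorem MonicPencil.positivitySet_eq_invertibilitySet (L : MonicPencil g ℓ) :
    L.positivitySet = invertibilitySet L.toMatPoly := by
  have hL := L.isOpenMatrixConvex
  refine eq_invertibilitySet_of_isUnit hL (fun n => ?_) fun n X hX => ?_
  · set S : Set (SymTuple g n) := {X | ∃ x, x ⬝ᵥ (L.eval X *ᵥ x) < 0}
    have hS : IsOpen S := by
      have : S = ⋃ x, {X | x ⬝ᵥ (L.eval X *ᵥ x) < 0} := by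
        ext X
        simp [S]
      rw [this]
      refine isOpen_iUnion fun x => isOpen_lt ?_ continuous_const
      exact continuous_const.dotProduct (L.continuous_eval.matrix_mulVec continuous_const)
    have hdisj : Disjoint (L.positivitySet n) S := by
      refine Set.disjoint_left.2 fun X hX ⟨x, hx⟩ => ?_
      have := (Matrix.PosDef.posSemidef hX).dotProduct_mulVec_nonneg x
      exact absurd hx (not_lt.2 this)
    refine isPreconnected_connectedComponentIn.subset_left_of_subset_union (hL.isOpen n) hS hdisj
      ?_ ?_
    · intro X hX
      have hu := isUnit_eval_of_mem_invertibilitySet hX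
      rw [L.eval_toMatPoly] at hu
      by_cases hXS : X ∈ S
      · exact .inr hXS
      · left
        simp only [S, Set.mem_ofPred_eq, not_exists, not_lt] at hXS
        have hpsd : (L.eval X).PosSemidef :=
          Matrix.PosSemidef.of_dotProduct_mulVec_nonneg (L.isHermitian_eval X) hXS
        exact hpsd.posDef_iff_isUnit.2 hu
    · refine ⟨0, mem_connectedComponentIn ?_, hL.zero_mem n⟩
      rw [mem_invertibleAt, L.eval_toMatPoly]
      exact Matrix.PosDef.isUnit (hL.zero_mem n)
  · rw [L.eval_toMatPoly]
    exact Matrix.PosDef.isUnit hX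

theorem MonicPencil.isNCOpenSemialgebraic (L : MonicPencil g ℓ) (hℓ : 0 < ℓ) :
    IsNCOpenSemialgebraic L.positivitySet := by
  refine ⟨1, fun _ => L.positivitySet, fun _ => ⟨ℓ, hℓ, L.toMatPoly, L.isSymmetric_toMatPoly, ?_,
    L.positivitySet_eq_invertibilitySet⟩, fun n => (Set.iUnion_const _).symm⟩
  rw [L.constTerm_toMatPoly]
  exact isUnit_one

/-! ### Linear functionals on symmetric matrices -/

/-- The symmetric part `(A + Aᵀ) / 2`. -/
noncomputable def symPart (n : ℕ) : Matrix (Fin n) (Fin n) ℝ →ₗ[ℝ] SymMat n where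
  toFun A := ⟨(1 / 2 : ℝ) • (A + Aᵀ), (SymMat n).smul_mem _ (Matrix.isSymm_add_transpose_self A)⟩
  map_add' A B := by
    ext1
    simp only [Matrix.transpose_add, Submodule.coe_add]
    module
  map_smul' c A := by
    ext1
    simp only [Matrix.transpose_smul, Submodule.coe_smul, RingHom.id_apply]
    module

theorem symPart_coe (Z : SymMat n) : symPart n Z = Z := by
  ext1
  change (1 / 2 : ℝ) • ((Z : Matrix (Fin n) (Fin n) ℝ) + (Z : Matrix (Fin n) (Fin n) ℝ)ᵀ) = Z
  rw [show (Z : Matrix (Fin n) (Fin n) ℝ)ᵀ = Z from Z.2]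
  module

/-- The entries of `B` are the values of `φ` on symmetrised matrix units. -/
theorem exists_trace_eq (φ : SymMat n →ₗ[ℝ] ℝ) :
    ∃ B : SymMat n, ∀ Z : SymMat n,
      φ Z = ((B : Matrix (Fin n) (Fin n) ℝ) * (Z : Matrix (Fin n) (Fin n) ℝ)).trace := by
  have hs : ∀ a b : Fin n, symPart n (Matrix.single a b 1) = symPart n (Matrix.single b a 1) := by
    intro a b
    ext1
    simp only [symPart, LinearMap.coe_mk, AddHom.coe_mk, Matrix.transpose_single]
    rw [add_comm]
  refine ⟨⟨Matrix.of fun a b => φ (symPart n (Matrix.single a b 1)), ?_⟩, fun Z => ?_⟩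
  · ext a b
    simp [hs a b]
  · have h1 : φ Z = ∑ a, ∑ b, (Z : Matrix (Fin n) (Fin n) ℝ) a b *
        φ (symPart n (Matrix.single a b 1)) := by
      conv_lhs => rw [← symPart_coe Z, Matrix.matrix_eq_sum_single (Z : Matrix (Fin n) (Fin n) ℝ)]
      simp only [map_sum]
      refine Finset.sum_congr rfl fun a _ => Finset.sum_congr rfl fun b _ => ?_
      rw [← smul_eq_mul, ← map_smul, ← map_smul, Matrix.smul_single, smul_eq_mul, mul_one]
    rw [h1, Matrix.trace_mul_comm]
    simp only [Matrix.trace, Matrix.diag, Matrix.mul_apply, Matrix.of_apply]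
    refine Finset.sum_congr rfl fun a _ => Finset.sum_congr rfl fun b _ => ?_
    rw [hs a b]

theorem exists_sum_trace_eq (f : SymTuple g n →ₗ[ℝ] ℝ) :
    ∃ B : SymTuple g n, ∀ Z : SymTuple g n,
      f Z = ∑ j, ((B j : Matrix (Fin n) (Fin n) ℝ) * (Z j : Matrix (Fin n) (Fin n) ℝ)).trace := by
  choose B hB using fun j => exists_trace_eq (f ∘ₗ LinearMap.single ℝ (fun _ => SymMat n) j)
  refine ⟨B, fun Z => ?_⟩
  simp only [← hB, LinearMap.comp_apply, LinearMap.single_apply, ← map_sum]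
  rw [Finset.univ_sum_single]

/-! ### A factorization of positive semidefinite matrices -/

/-- For `T = V D Vᵀ` take `R = √D Vᵀ` and its pseudo-inverse `S`. Since `0⁻¹ = 0`, `R * S` is a
diagonal projection, even for singular `T`. -/
theorem exists_factorization {T : Matrix (Fin n) (Fin n) ℝ} (hT : T.PosSemidef) :
    ∃ R S : Matrix (Fin n) (Fin n) ℝ, T = Rᵀ * R ∧ R * S * R = R ∧
      ∀ {k : ℕ} (U : Matrix (Fin k) (Fin n) ℝ), sqNorm (U * (R * S)ᵀ) ≤ sqNorm U := by
  have hH := hT.isHermitian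
  set V : Matrix (Fin n) (Fin n) ℝ := (hH.eigenvectorUnitary : Matrix (Fin n) (Fin n) ℝ)
  set d : Fin n → ℝ := hH.eigenvalues
  have hd : ∀ i, 0 ≤ d i := hT.eigenvalues_nonneg
  have hV : Vᵀ * V = 1 := by
    have := Unitary.coe_star_mul_self hH.eigenvectorUnitary
    rwa [Matrix.star_eq_conjTranspose, Matrix.conjTranspose_eq_transpose_of_trivial] at this
  have hTV : T = V * Matrix.diagonal d * Vᵀ := by
    have := hH.spectral_theorem
    rw [Unitary.conjStarAlgAut_apply, Matrix.star_eq_conjTranspose,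
      Matrix.conjTranspose_eq_transpose_of_trivial] at this
    exact this
  have hRS : Matrix.diagonal (fun i => √(d i)) * Vᵀ * (V * Matrix.diagonal fun i => (√(d i))⁻¹) =
      Matrix.diagonal fun i => √(d i) * (√(d i))⁻¹ := by
    rw [Matrix.mul_assoc, ← Matrix.mul_assoc Vᵀ, hV, Matrix.one_mul, Matrix.diagonal_mul_diagonal]
  refine ⟨Matrix.diagonal (fun i => √(d i)) * Vᵀ, V * Matrix.diagonal fun i => (√(d i))⁻¹,
    ?_, ?_, fun {k} U => ?_⟩
  · rw [Matrix.transpose_mul, Matrix.transpose_transpose, Matrix.diagonal_transpose,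
      Matrix.mul_assoc, ← Matrix.mul_assoc (Matrix.diagonal _), Matrix.diagonal_mul_diagonal,
      ← Matrix.mul_assoc]
    simpa only [Real.mul_self_sqrt (hd _)] using hTV
  · rw [hRS, ← Matrix.mul_assoc, Matrix.diagonal_mul_diagonal]
    simp only [mul_inv_mul_cancel]
  · rw [hRS, Matrix.diagonal_transpose, sqNorm_eq_sum, sqNorm_eq_sum]
    refine Finset.sum_le_sum fun b _ => Finset.sum_le_sum fun a _ => ?_
    simp only [Matrix.col_apply, Matrix.mul_diagonal]
    rcases eq_or_ne (√(d b)) 0 with h0 | h0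
    · simp only [h0, zero_mul, mul_zero]
      exact mul_self_nonneg _
    · rw [mul_inv_cancel₀ h0, mul_one]

/-! ### Separation -/

theorem conj_smul (c : ℝ) (F : Matrix (Fin m) (Fin k) ℝ) (X : SymTuple g m) :
    conj (c • F) X = (c * c) • conj F X := by
  ext1 j
  simp [conj, smul_smul]

theorem conj_smul_right (c : ℝ) (F : Matrix (Fin m) (Fin k) ℝ) (X : SymTuple g m) :
    conj F (c • X) = c • conj F X := by
  ext1 j
  simp [conj]

theorem dotProduct_transpose_mul_self (F : Matrix (Fin m) (Fin k) ℝ) (x : Fin k → ℝ) :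
    x ⬝ᵥ ((Fᵀ * F) *ᵥ x) = (F *ᵥ x) ⬝ᵥ (F *ᵥ x) := by
  rw [Matrix.dotProduct_mulVec (F *ᵥ x), Matrix.vecMul_mulVec, Matrix.dotProduct_mulVec]

theorem dotProduct_self_pos {x : Fin n → ℝ} (hx : x ≠ 0) : 0 < x ⬝ᵥ x :=
  lt_of_le_of_ne (Finset.sum_nonneg fun _ _ => mul_self_nonneg _)
    fun h => hx (dotProduct_self_eq_zero.1 h.symm)

/-- The Gram matrix `FᵀF - f(FᵀYF)` is never negative definite. -/
theorem IsOpenMatrixConvex.exists_gram_nonneg {C : NCSet g} (hC : IsOpenMatrixConvex C)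
    {f : SymTuple g n →ₗ[ℝ] ℝ} (hn : n ≠ 0) (hf : ∀ Y ∈ C n, f Y < 1)
    {Y : SymTuple g m} (hY : Y ∈ C m) (F : Matrix (Fin m) (Fin n) ℝ) :
    ∃ x, x ≠ 0 ∧ f (conj F Y) * (x ⬝ᵥ x) ≤ (F *ᵥ x) ⬝ᵥ (F *ᵥ x) := by
  by_contra! H
  set c := f (conj F Y)
  have hc : 0 < c := by
    have : Nonempty (Fin n) := ⟨⟨0, Nat.pos_of_ne_zero hn⟩⟩
    have h1 : (1 : Fin n → ℝ) ≠ 0 := one_ne_zero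
    have h2 := H 1 h1
    have h3 : 0 ≤ (F *ᵥ 1) ⬝ᵥ (F *ᵥ 1) := Finset.sum_nonneg fun _ _ => mul_self_nonneg _
    exact (mul_pos_iff_of_pos_right (dotProduct_self_pos h1)).1 (h3.trans_lt h2)
  have hcs : (√c)⁻¹ * (√c)⁻¹ = c⁻¹ := by
    rw [← mul_inv, Real.mul_self_sqrt hc.le]
  -- Rescaling by `c^(-1/2)` keeps the conjugate in `C` but gives it the value `f = 1`.
  have hF : IsContraction ((√c)⁻¹ • F) := by
    refine isContraction_iff.2 fun x => ?_
    rcases eq_or_ne x 0 with rfl | hx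
    · simp
    · rw [Matrix.smul_mulVec, smul_dotProduct, dotProduct_smul, smul_smul, hcs, smul_eq_mul,
        inv_mul_le_iff₀ hc]
      exact (H x hx).le
  have := hf _ (hC.conj_mem m n _ hF Y hY)
  rw [conj_smul, hcs, map_smul, smul_eq_mul, inv_mul_cancel₀ hc.ne'] at this
  exact lt_irrefl _ this

/-- A functional which is less than `1` on a matrix convex set is dominated by a state. -/
theorem IsOpenMatrixConvex.exists_state {C : NCSet g} (hC : IsOpenMatrixConvex C)
    {f : SymTuple g n →ₗ[ℝ] ℝ} (hn : n ≠ 0) (hf : ∀ Y ∈ C n, f Y < 1) :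
    ∃ T : Matrix (Fin n) (Fin n) ℝ, T.PosSemidef ∧ T.trace = 1 ∧
      ∀ m, ∀ Y ∈ C m, ∀ F : Matrix (Fin m) (Fin n) ℝ, f (conj F Y) ≤ (T * (Fᵀ * F)).trace := by
  set s : Set (SymMat n) := {N | ∀ x, x ≠ 0 → 0 < x ⬝ᵥ ((-(N : Matrix (Fin n) (Fin n) ℝ)) *ᵥ x)}
  set 𝒢 : Set (SymMat n) := {G | ∃ m, ∃ Y ∈ C m, ∃ F : Matrix (Fin m) (Fin n) ℝ,
    (G : Matrix (Fin n) (Fin n) ℝ) = Fᵀ * F - f (conj F Y) • 1}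
  have hs_open : IsOpen s := (isOpen_setOf_posForm (Fin n)).preimage
    (continuous_subtype_val.neg)
  have hs_convex : Convex ℝ s := by
    intro N hN M hM a b ha hb hab x hx
    have h1 := hN x hx
    have h2 := hM x hx
    have h3 : x ⬝ᵥ ((-((a • N + b • M : SymMat n) : Matrix (Fin n) (Fin n) ℝ)) *ᵥ x) =
        a * (x ⬝ᵥ ((-(N : Matrix (Fin n) (Fin n) ℝ)) *ᵥ x)) +
        b * (x ⬝ᵥ ((-(M : Matrix (Fin n) (Fin n) ℝ)) *ᵥ x)) := by
      simp only [Submodule.coe_add, Submodule.coe_smul, Matrix.neg_mulVec, Matrix.add_mulVec,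
        Matrix.smul_mulVec, dotProduct_neg, dotProduct_add, dotProduct_smul, smul_eq_mul]
      ring
    rw [h3]
    rcases ha.eq_or_lt with rfl | ha
    · have : b = 1 := by linarith
      subst this
      linarith
    · have := mul_pos ha h1
      have := mul_nonneg hb h2.le
      linarith
  have h𝒢_smul : ∀ G ∈ 𝒢, ∀ c : ℝ, 0 ≤ c → c • G ∈ 𝒢 := by
    rintro G ⟨m, Y, hY, F, hG⟩ c hc
    refine ⟨m, Y, hY, √c • F, ?_⟩
    rw [conj_smul, Real.mul_self_sqrt hc, map_smul, Submodule.coe_smul, hG,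
      Matrix.transpose_smul, Matrix.smul_mul, Matrix.mul_smul, smul_smul, Real.mul_self_sqrt hc,
      smul_sub, smul_smul, smul_eq_mul]
  -- Matrix convexity enters here: stacking `F` over `F'` on `Y ⊕ Y'` adds Gram matrices.
  have h𝒢_add : ∀ G ∈ 𝒢, ∀ H ∈ 𝒢, G + H ∈ 𝒢 := by
    rintro G ⟨m, Y, hY, F, hG⟩ H ⟨m', Y', hY', F', hH⟩
    refine ⟨m + m', directSum Y Y', hC.directSum_mem _ _ _ hY _ hY',
      (Matrix.fromRows F F').reindex finSumFinEquiv (Equiv.refl _), ?_⟩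
    rw [conj_stack, stack_transpose_mul_self, Submodule.coe_add, hG, hH, map_add, add_smul]
    abel
  have h𝒢_convex : Convex ℝ 𝒢 := fun G hG H hH a b ha hb _ =>
    h𝒢_add _ (h𝒢_smul G hG a ha) _ (h𝒢_smul H hH b hb)
  have hdisj : Disjoint s 𝒢 := by
    refine Set.disjoint_left.2 ?_
    rintro G hs ⟨m, Y, hY, F, hG⟩
    obtain ⟨x, hx, hle⟩ := hC.exists_gram_nonneg hn hf hY F
    have := hs x hx
    rw [hG, Matrix.neg_mulVec, Matrix.sub_mulVec, dotProduct_neg, dotProduct_sub,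
      dotProduct_transpose_mul_self, Matrix.smul_mulVec, Matrix.one_mulVec, dotProduct_smul,
      smul_eq_mul] at this
    linarith
  obtain ⟨φ, u, hφs, hφ𝒢⟩ := geometric_hahn_banach_open hs_convex hs_open h𝒢_convex hdisj
  have hG0 : (0 : SymMat n) ∈ 𝒢 := ⟨0, 0, hC.zero_mem 0, 0, by
    have : conj (0 : Matrix (Fin 0) (Fin n) ℝ) (0 : SymTuple g 0) = 0 := by
      ext1 j
      simp [conj]
    simp [this]⟩
  have hu : u ≤ 0 := by simpa using hφ𝒢 0 hG0
  have hφ_nonneg : ∀ G ∈ 𝒢, 0 ≤ φ G := by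
    intro G hG
    by_contra! hneg
    -- This multiple of `G` has `φ`-value `u - 1`, below the separating constant.
    have := hφ𝒢 _ (h𝒢_smul G hG ((u - 1) / φ G) (div_nonneg_of_nonpos (by linarith) hneg.le))
    rw [map_smul, smul_eq_mul, div_mul_cancel₀ _ hneg.ne] at this
    linarith
  obtain ⟨T, hT⟩ := exists_trace_eq (φ : SymMat n →ₗ[ℝ] ℝ)
  replace hT : ∀ Z : SymMat n, φ Z =
    ((T : Matrix (Fin n) (Fin n) ℝ) * (Z : Matrix (Fin n) (Fin n) ℝ)).trace := hT
  set τ := (T : Matrix (Fin n) (Fin n) ℝ).trace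
  -- Test `φ` on `-(x xᵀ + ε I)`; the `ε` makes the matrix strictly negative definite. The case `x =
  -- 0` gives `τ > 0`.
  have hneg : ∀ (x : Fin n → ℝ) (ε : ℝ), 0 < ε →
      0 < x ⬝ᵥ ((T : Matrix (Fin n) (Fin n) ℝ) *ᵥ x) + ε * τ := by
    intro x ε hε
    have hsym : (-(Matrix.vecMulVec x x + ε • (1 : Matrix (Fin n) (Fin n) ℝ))).IsSymm := by
      unfold Matrix.IsSymm
      simp [Matrix.transpose_vecMulVec]
    have hmem : (⟨_, hsym⟩ : SymMat n) ∈ s := by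
      intro y hy
      change 0 < y ⬝ᵥ ((-(-(Matrix.vecMulVec x x + ε • (1 : Matrix (Fin n) (Fin n) ℝ)))) *ᵥ y)
      rw [neg_neg, Matrix.add_mulVec, dotProduct_add, Matrix.smul_mulVec, Matrix.one_mulVec,
        dotProduct_smul, Matrix.vecMulVec_mulVec, smul_eq_mul]
      have h1 := mul_pos hε (dotProduct_self_pos hy)
      have h2 : 0 ≤ y ⬝ᵥ (MulOpposite.op (x ⬝ᵥ y) • x) := by
        rw [op_smul_eq_smul, dotProduct_smul, dotProduct_comm y x, smul_eq_mul]
        exact mul_self_nonneg _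
      linarith
    have := (hφs _ hmem).trans_le hu
    rw [hT] at this
    change ((T : Matrix (Fin n) (Fin n) ℝ) *
      (-(Matrix.vecMulVec x x + ε • (1 : Matrix (Fin n) (Fin n) ℝ)))).trace < 0 at this
    rw [Matrix.mul_neg, Matrix.trace_neg, Matrix.mul_add, Matrix.trace_add, Matrix.mul_smul,
      Matrix.mul_one, Matrix.trace_smul, Matrix.mul_vecMulVec, Matrix.trace_vecMulVec,
      smul_eq_mul, dotProduct_comm] at this
    linarith
  have hτ : 0 < τ := by simpa using hneg 0 1 one_pos
  have hTpsd : (T : Matrix (Fin n) (Fin n) ℝ).PosSemidef := by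
    refine Matrix.PosSemidef.of_dotProduct_mulVec_nonneg ?_ fun x => ?_
    · rw [Matrix.IsHermitian, Matrix.conjTranspose_eq_transpose_of_trivial]
      exact T.2
    · rw [star_trivial]
      by_contra! hx
      have := hneg x (-(x ⬝ᵥ ((T : Matrix (Fin n) (Fin n) ℝ) *ᵥ x)) / τ)
        (div_pos (neg_pos.2 hx) hτ)
      rw [div_mul_cancel₀ _ hτ.ne'] at this
      linarith
  refine ⟨τ⁻¹ • (T : Matrix (Fin n) (Fin n) ℝ), hTpsd.smul (inv_pos.2 hτ).le, ?_, ?_⟩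
  · rw [Matrix.trace_smul, smul_eq_mul, inv_mul_cancel₀ hτ.ne']
  · intro m Y hY F
    have hsym : (Fᵀ * F - f (conj F Y) • (1 : Matrix (Fin n) (Fin n) ℝ)).IsSymm := by
      unfold Matrix.IsSymm
      simp
    have := hφ_nonneg ⟨_, hsym⟩ ⟨m, Y, hY, F, rfl⟩
    rw [hT] at this
    change 0 ≤ ((T : Matrix (Fin n) (Fin n) ℝ) *
      (Fᵀ * F - f (conj F Y) • (1 : Matrix (Fin n) (Fin n) ℝ))).trace at this
    rw [Matrix.mul_sub, Matrix.trace_sub, Matrix.mul_smul, Matrix.mul_one, Matrix.trace_smul,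
      smul_eq_mul] at this
    rw [Matrix.smul_mul, Matrix.trace_smul, smul_eq_mul, le_inv_mul_iff₀ hτ, mul_comm]
    linarith

/-- Small scalar points `± t e_j` belong to `C 1`, so `T ± t B_j` is semidefinite. On the kernel of
`T` both signs force the form of `B_j` to vanish, hence `B_j x = 0`. -/
theorem IsOpenMatrixConvex.mulVec_eq_zero_of_state {C : NCSet g} (hC : IsOpenMatrixConvex C)
    {f : SymTuple g n →ₗ[ℝ] ℝ} {B : SymTuple g n}
    (hB : ∀ Z : SymTuple g n,
      f Z = ∑ j, ((B j : Matrix (Fin n) (Fin n) ℝ) * (Z j : Matrix (Fin n) (Fin n) ℝ)).trace)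
    {T : Matrix (Fin n) (Fin n) ℝ} (hT : T.PosSemidef)
    (hTf : ∀ Y ∈ C 1, ∀ F : Matrix (Fin 1) (Fin n) ℝ, f (conj F Y) ≤ (T * (Fᵀ * F)).trace)
    {x : Fin n → ℝ} (hx : T *ᵥ x = 0) (j : Fin g) :
    (B j : Matrix (Fin n) (Fin n) ℝ) *ᵥ x = 0 := by
  set e : SymMat 1 := ⟨1, Matrix.isSymm_one⟩
  obtain ⟨ε, hε, hball⟩ : ∃ ε > 0, ∀ t : ℝ, |t| < ε → t • (Pi.single j e : SymTuple g 1) ∈ C 1 := by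
    have hcont : Continuous fun t : ℝ => t • (Pi.single j e : SymTuple g 1) := by fun_prop
    obtain ⟨ε, hε, h⟩ := Metric.isOpen_iff.1 ((hC.isOpen 1).preimage hcont) 0 (by
      simpa using hC.zero_mem 1)
    exact ⟨ε, hε, fun t ht => h (by simpa using ht)⟩
  have key : ∀ t : ℝ, |t| < ε → (T - t • (B j : Matrix (Fin n) (Fin n) ℝ)).PosSemidef := by
    intro t ht
    refine Matrix.PosSemidef.of_dotProduct_mulVec_nonneg ?_ fun z => ?_
    · refine hT.isHermitian.sub ?_
      rw [Matrix.IsHermitian, Matrix.conjTranspose_eq_transpose_of_trivial,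
        Matrix.transpose_smul, SymTuple.transpose_coe]
    · have hz : (Matrix.replicateRow (Fin 1) z)ᵀ * Matrix.replicateRow (Fin 1) z =
          Matrix.vecMulVec z z := by
        ext a b
        simp [Matrix.mul_apply, Matrix.vecMulVec_apply]
      have h1 := hTf _ (hball t ht) (Matrix.replicateRow (Fin 1) z)
      have h2 : f (conj (Matrix.replicateRow (Fin 1) z) (Pi.single j e : SymTuple g 1)) =
          z ⬝ᵥ ((B j : Matrix (Fin n) (Fin n) ℝ) *ᵥ z) := by
        rw [hB, Finset.sum_eq_single j]
        · simp only [conj, Pi.single_eq_same, e, Matrix.mul_one, hz]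
          rw [Matrix.mul_vecMulVec, Matrix.trace_vecMulVec, dotProduct_comm]
        · intro i _ hi
          simp [conj, Pi.single_eq_of_ne hi]
        · simp
      rw [conj_smul_right, map_smul, h2, hz, Matrix.mul_vecMulVec, Matrix.trace_vecMulVec,
        smul_eq_mul] at h1
      rw [star_trivial, Matrix.sub_mulVec, Matrix.smul_mulVec, dotProduct_sub, dotProduct_smul,
        smul_eq_mul, dotProduct_comm z (T *ᵥ z)]
      linarith
  have hval : ∀ t : ℝ, x ⬝ᵥ ((T - t • (B j : Matrix (Fin n) (Fin n) ℝ)) *ᵥ x) =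
      -(t * (x ⬝ᵥ ((B j : Matrix (Fin n) (Fin n) ℝ) *ᵥ x))) := by
    intro t
    rw [Matrix.sub_mulVec, hx, Matrix.smul_mulVec, zero_sub, dotProduct_neg, dotProduct_smul,
      smul_eq_mul]
  have hlt : |ε / 2| < ε := by rw [abs_of_pos (by positivity)]; linarith
  have hp := key (ε / 2) hlt
  have hm := key (-(ε / 2)) (by rwa [abs_neg])
  have h1 := hp.dotProduct_mulVec_nonneg x
  have h2 := hm.dotProduct_mulVec_nonneg x
  rw [star_trivial, hval] at h1 h2
  have h0 : ε / 2 * (x ⬝ᵥ ((B j : Matrix (Fin n) (Fin n) ℝ) *ᵥ x)) = 0 := by linarith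
  have h3 := (hp.dotProduct_mulVec_zero_iff x).1 (by rw [star_trivial, hval, h0, neg_zero])
  rw [Matrix.sub_mulVec, hx, Matrix.smul_mulVec, zero_sub, neg_eq_zero] at h3
  exact (smul_eq_zero.1 h3).resolve_left (by positivity)

/-- The Effros–Winkler separation theorem: a point outside an open matrix convex set is cut off
by a monic pencil of the size of the point. -/
theorem IsOpenMatrixConvex.exists_separating_pencil {C : NCSet g} (hC : IsOpenMatrixConvex C)
    {X : SymTuple g n} (hX : X ∉ C n) :
    ∃ L : MonicPencil g n, (∀ m, ∀ Y ∈ C m, ∀ U, 0 ≤ L.quadForm Y U) ∧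
      ∃ U, U ≠ 0 ∧ L.quadForm X U = 0 := by
  have hn : n ≠ 0 := by
    rintro rfl
    exact hX (by convert hC.zero_mem 0 using 1; exact Subsingleton.elim _ _)
  obtain ⟨f₀, hf₀⟩ := geometric_hahn_banach_open_point (hC.convex n) (hC.isOpen n) hX
  have hpos : 0 < f₀ X := by simpa using hf₀ 0 (hC.zero_mem n)
  set f : SymTuple g n →ₗ[ℝ] ℝ := (f₀ X)⁻¹ • (f₀ : SymTuple g n →ₗ[ℝ] ℝ)
  have hf : ∀ Y ∈ C n, f Y < 1 := by
    intro Y hY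
    change (f₀ X)⁻¹ * f₀ Y < 1
    rw [inv_mul_lt_iff₀ hpos, mul_one]
    exact hf₀ Y hY
  have hfX : f X = 1 := inv_mul_cancel₀ hpos.ne'
  obtain ⟨T, hT, hTtr, hTf⟩ := hC.exists_state hn hf
  obtain ⟨B, hB⟩ := exists_sum_trace_eq f
  obtain ⟨R, S, hTR, hRSR, hRS⟩ := exists_factorization hT
  -- Normalising by the pseudo-inverse `S` makes the pencil monic: its form at `Y` is `‖U‖² - f((U
  -- Sᵀ)ᵀ Y (U Sᵀ))`, and the state bounds the last term by `‖U (R S)ᵀ‖² ≤ ‖U‖²`.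
  set L : MonicPencil g n := ⟨-conj S B⟩
  have hlin : ∀ {m : ℕ} (Y : SymTuple g m) (U : Matrix (Fin m) (Fin n) ℝ),
      L.linForm Y U = -f (conj (U * Sᵀ) Y) := by
    intro m Y U
    rw [hB, MonicPencil.linForm, ← Finset.sum_neg_distrib]
    refine Finset.sum_congr rfl fun j _ => ?_
    change (Uᵀ * (Y j : Matrix (Fin m) (Fin m) ℝ) * U *
      (-(Sᵀ * (B j : Matrix (Fin n) (Fin n) ℝ) * S))).trace = -((B j : Matrix (Fin n) (Fin n) ℝ) *
      ((U * Sᵀ)ᵀ * (Y j : Matrix (Fin m) (Fin m) ℝ) * (U * Sᵀ))).trace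
    rw [Matrix.mul_neg, Matrix.trace_neg, Matrix.transpose_mul, Matrix.transpose_transpose,
      ← Matrix.mul_assoc, ← Matrix.mul_assoc, Matrix.trace_mul_comm,
      Matrix.trace_mul_comm (B j : Matrix (Fin n) (Fin n) ℝ)]
    simp only [Matrix.mul_assoc]
  refine ⟨L, fun m Y hY U => ?_, Rᵀ, fun h0 => ?_, ?_⟩
  · have h1 := hTf m Y hY (U * Sᵀ)
    have h2 := hRS U
    have h3 : (T * ((U * Sᵀ)ᵀ * (U * Sᵀ))).trace = sqNorm (U * (R * S)ᵀ) := by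
      rw [hTR, sqNorm]
      simp only [Matrix.transpose_mul, Matrix.transpose_transpose, Matrix.mul_assoc]
      rw [Matrix.trace_mul_comm]
      simp only [Matrix.mul_assoc]
    rw [MonicPencil.quadForm, hlin]
    linarith
  · rw [hTR, h0, Matrix.zero_mul, Matrix.trace_zero] at hTtr
    exact zero_ne_one hTtr
  -- The columns of `S * R - 1` lie in the kernel of `T`, hence in that of each `B j`; so
  -- conjugation by `Rᵀ Sᵀ` preserves `f X = 1`, while `‖Rᵀ‖² = tr T = 1`.
  · have hBk : ∀ j, (B j : Matrix (Fin n) (Fin n) ℝ) * (S * R) = B j := by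
      intro j
      rw [← sub_eq_zero, ← Matrix.mul_one (B j : Matrix (Fin n) (Fin n) ℝ), Matrix.mul_assoc,
        ← Matrix.mul_sub, Matrix.one_mul]
      have hT0 : T * (S * R - 1) = 0 := by
        rw [hTR, Matrix.mul_assoc, Matrix.mul_sub, ← Matrix.mul_assoc R, hRSR, Matrix.mul_one,
          sub_self, Matrix.mul_zero]
      ext a b
      have hcol : T *ᵥ (S * R - 1).col b = 0 := funext fun i => congrFun (congrFun hT0 i) b
      exact congrFun (hC.mulVec_eq_zero_of_state hB hT (hTf 1) hcol j) a
    have hBk' : ∀ j, (S * R)ᵀ * (B j : Matrix (Fin n) (Fin n) ℝ) = B j := by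
      intro j
      have := congrArg Matrix.transpose (hBk j)
      rwa [Matrix.transpose_mul, SymTuple.transpose_coe] at this
    have h1 : sqNorm Rᵀ = 1 := by
      rw [sqNorm, Matrix.transpose_transpose, Matrix.trace_mul_comm, ← hTR, hTtr]
    have h2 : f (conj (Rᵀ * Sᵀ) X) = 1 := by
      rw [← hfX, hB, hB]
      refine Finset.sum_congr rfl fun j _ => ?_
      change ((B j : Matrix (Fin n) (Fin n) ℝ) *
        ((Rᵀ * Sᵀ)ᵀ * (X j : Matrix (Fin n) (Fin n) ℝ) * (Rᵀ * Sᵀ))).trace = _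
      rw [← Matrix.transpose_mul, Matrix.transpose_transpose, ← Matrix.mul_assoc,
        ← Matrix.mul_assoc, hBk, Matrix.trace_mul_comm, ← Matrix.mul_assoc, hBk']
    rw [MonicPencil.quadForm, hlin, h1, h2]
    norm_num

/-! ### Polynomials of bounded degree -/

/-- The span of `1` and the variables. -/
def affineSpan (g : ℕ) : Submodule ℝ (FreeAlgebra ℝ (Fin g)) :=
  Submodule.span ℝ (insert 1 (Set.range (FreeAlgebra.ι ℝ)))

theorem one_mem_affineSpan : (1 : FreeAlgebra ℝ (Fin g)) ∈ affineSpan g :=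
  Submodule.subset_span (Set.mem_insert _ _)

theorem ι_mem_affineSpan (j : Fin g) : FreeAlgebra.ι ℝ j ∈ affineSpan g :=
  Submodule.subset_span (Set.mem_insert_of_mem _ ⟨j, rfl⟩)

/-- Because the span contains `1`, its `d`-th power consists of all polynomials of degree at most
`d`. -/
theorem affineSpan_pow_mono : Monotone fun d => affineSpan g ^ d := by
  refine monotone_nat_of_le_succ fun d q hq => ?_
  rw [pow_succ', ← one_mul q]
  exact Submodule.mul_mem_mul one_mem_affineSpan hq

theorem one_mem_affineSpan_pow (d : ℕ) : (1 : FreeAlgebra ℝ (Fin g)) ∈ affineSpan g ^ d :=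
  affineSpan_pow_mono (Nat.zero_le d) (by simp [Submodule.mem_one])

theorem exists_mem_affineSpan_pow (q : FreeAlgebra ℝ (Fin g)) : ∃ d, q ∈ affineSpan g ^ d := by
  induction q using FreeAlgebra.induction with
  | grade0 r => exact ⟨0, by simp [Submodule.mem_one]⟩
  | grade1 j => exact ⟨1, by simpa using ι_mem_affineSpan j⟩
  | mul a b ha hb =>
    obtain ⟨d, hd⟩ := ha
    obtain ⟨e, he⟩ := hb
    exact ⟨d + e, by rw [pow_add]; exact Submodule.mul_mem_mul hd he⟩
  | add a b ha hb =>
    obtain ⟨d, hd⟩ := ha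
    obtain ⟨e, he⟩ := hb
    exact ⟨max d e, add_mem (affineSpan_pow_mono (le_max_left d e) hd)
      (affineSpan_pow_mono (le_max_right d e) he)⟩

/-- Rows of `δ` polynomials of degree at most `d`. -/
def rowSpan (g δ d : ℕ) : Submodule ℝ (Fin δ → FreeAlgebra ℝ (Fin g)) :=
  Submodule.pi Set.univ fun _ => affineSpan g ^ d

theorem mem_rowSpan {q : Fin δ → FreeAlgebra ℝ (Fin g)} :
    q ∈ rowSpan g δ d ↔ ∀ i, q i ∈ affineSpan g ^ d := by
  simp [rowSpan, Submodule.mem_pi]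

instance : FiniteDimensional ℝ (rowSpan g δ d) := by
  have hfg : (affineSpan g ^ d).FG :=
    (Submodule.fg_span ((Set.finite_range _).insert 1)).pow d
  exact Module.Finite.iff_fg.2 (Submodule.fg_pi fun _ => hfg)

theorem rowSpan_mono : Monotone (rowSpan g δ) := fun _ _ hde _ hq =>
  mem_rowSpan.2 fun i => affineSpan_pow_mono hde (mem_rowSpan.1 hq i)

theorem exists_mem_rowSpan (p : MatPoly g δ) : ∃ d, ∀ i, p i ∈ rowSpan g δ d := by
  choose D hD using fun ij : Fin δ × Fin δ => exists_mem_affineSpan_pow (p ij.1 ij.2)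
  exact ⟨Finset.univ.sup D, fun i => mem_rowSpan.2 fun j =>
    affineSpan_pow_mono (Finset.le_sup (Finset.mem_univ (i, j))) (hD (i, j))⟩

/-! ### Compressions -/

/-- The columns of `F` form an orthonormal basis of `M`, so `F Fᵀ` is the orthogonal projection onto
`M`. -/
theorem exists_isometry_onto (M : Submodule ℝ (Fin n → ℝ)) :
    ∃ r, ∃ F : Matrix (Fin n) (Fin r) ℝ, Fᵀ * F = 1 ∧ (∀ u ∈ M, F *ᵥ (Fᵀ *ᵥ u) = u) ∧
      ∀ y, F *ᵥ y ∈ M := by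
  set e := (WithLp.linearEquiv 2 ℝ (Fin n → ℝ)).symm
  set M' : Submodule ℝ (EuclideanSpace ℝ (Fin n)) := M.map (e : (Fin n → ℝ) →ₗ[ℝ] _)
  set b := stdOrthonormalBasis ℝ M'
  set F : Matrix (Fin n) (Fin (Module.finrank ℝ M')) ℝ :=
    Matrix.of fun a i => (b i : EuclideanSpace ℝ (Fin n)) a
  have hFT : ∀ (u : EuclideanSpace ℝ (Fin n)) i, (Fᵀ *ᵥ u.ofLp) i =
      inner ℝ (b i : EuclideanSpace ℝ (Fin n)) u := by
    intro u i
    simp [F, Matrix.mulVec, dotProduct, PiLp.inner_apply, mul_comm]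
  have hF : ∀ y, F *ᵥ y = (∑ i, y i • (b i : EuclideanSpace ℝ (Fin n))).ofLp := by
    intro y
    ext a
    simp [F, Matrix.mulVec, dotProduct, mul_comm]
  refine ⟨_, F, ?_, fun u hu => ?_, fun y => ?_⟩
  · ext i j
    have h1 := hFT (b j : EuclideanSpace ℝ (Fin n)) i
    have h2 := orthonormal_iff_ite.1 b.orthonormal i j
    rw [Matrix.one_apply, ← h2]
    exact h1
  · have hu' : e u ∈ M' := Submodule.mem_map_of_mem hu
    have h1 := b.sum_repr' ⟨e u, hu'⟩
    have h2 := congrArg (fun z : M' => (z : EuclideanSpace ℝ (Fin n)).ofLp) h1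
    rw [hF]
    refine Eq.trans ?_ h2
    simp only [Submodule.coe_sum, Submodule.coe_smul]
    congr 1
    refine Finset.sum_congr rfl fun i _ => ?_
    exact congrArg (· • (b i : EuclideanSpace ℝ (Fin n))) (hFT (e u) i)
  · rw [hF]
    have : (∑ i, y i • (b i : EuclideanSpace ℝ (Fin n))) ∈ M' :=
      Submodule.sum_mem _ fun i _ => Submodule.smul_mem _ _ (b i).2
    obtain ⟨u, hu, hue⟩ := this
    rw [← hue]
    exact hu

/-- Induction on the degree: every vector reached before the last multiplication is fixed by `F Fᵀ`,
so the compression loses nothing. -/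
theorem evalHom_conj_mulVec {F : Matrix (Fin n) (Fin k) ℝ} {X : SymTuple g n} {w : Fin n → ℝ}
    (hF : ∀ q ∈ affineSpan g ^ d, F *ᵥ (Fᵀ *ᵥ (evalHom X q *ᵥ w)) = evalHom X q *ᵥ w) {e : ℕ}
    (he : e ≤ d) {q : FreeAlgebra ℝ (Fin g)} (hq : q ∈ affineSpan g ^ e) :
    evalHom (conj F X) q *ᵥ (Fᵀ *ᵥ w) = Fᵀ *ᵥ (evalHom X q *ᵥ w) := by
  induction e generalizing q with
  | zero =>
    rw [pow_zero, Submodule.mem_one] at hq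
    obtain ⟨r, rfl⟩ := hq
    rw [AlgHom.commutes, AlgHom.commutes, Algebra.algebraMap_eq_smul_one,
      Algebra.algebraMap_eq_smul_one, Matrix.smul_mulVec, Matrix.smul_mulVec, Matrix.one_mulVec,
      Matrix.one_mulVec, Matrix.mulVec_smul]
  | succ e ih =>
    rw [pow_succ'] at hq
    refine Submodule.mul_induction_on hq (fun s hs q hq => ?_) fun a b ha hb => ?_
    · have hq' := ih (by omega) hq
      have hfix := hF q (affineSpan_pow_mono (by omega : e ≤ d) hq)
      rw [map_mul, map_mul, ← Matrix.mulVec_mulVec, hq', ← Matrix.mulVec_mulVec]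
      set u := evalHom X q *ᵥ w
      refine Submodule.span_induction (p := fun s _ => evalHom (conj F X) s *ᵥ (Fᵀ *ᵥ u) =
        Fᵀ *ᵥ (evalHom X s *ᵥ u)) ?_ (by simp) (fun a b _ _ ha hb => ?_) (fun c a _ ha => ?_) hs
      · rintro s (rfl | ⟨j, rfl⟩)
        · simp
        · rw [evalHom_ι, evalHom_ι]
          change (Fᵀ * (X j : Matrix (Fin n) (Fin n) ℝ) * F) *ᵥ (Fᵀ *ᵥ u) = _
          rw [← Matrix.mulVec_mulVec, hfix, ← Matrix.mulVec_mulVec]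
      · simp only [map_add, Matrix.add_mulVec, Matrix.mulVec_add, ha, hb]
      · simp only [map_smul, Matrix.smul_mulVec, Matrix.mulVec_smul, ha]
    · simp only [map_add, Matrix.add_mulVec, Matrix.mulVec_add, ha, hb]

theorem rowEval_conj {F : Matrix (Fin n) (Fin k) ℝ} {X : SymTuple g n} {v : Fin δ → Fin n → ℝ}
    (hF : ∀ u ∈ (rowSpan g δ d).map (rowEval X v), F *ᵥ (Fᵀ *ᵥ u) = u)
    {q : Fin δ → FreeAlgebra ℝ (Fin g)} (hq : q ∈ rowSpan g δ d) :
    rowEval (conj F X) (fun i => Fᵀ *ᵥ v i) q = Fᵀ *ᵥ rowEval X v q := by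
  rw [rowEval_apply, rowEval_apply, Matrix.mulVec_sum]
  refine Finset.sum_congr rfl fun i _ => evalHom_conj_mulVec (d := d) (fun s hs => ?_) le_rfl
    (mem_rowSpan.1 hq i)
  refine hF _ ⟨Pi.single i s, mem_rowSpan.2 fun j => ?_, ?_⟩
  · rcases eq_or_ne j i with rfl | hj
    · simpa using hs
    · simp [Pi.single_eq_of_ne hj]
  · rw [rowEval_apply, Finset.sum_eq_single i]
    · simp
    · intro j _ hj
      simp [Pi.single_eq_of_ne hj]
    · simp

/-! ### Boundary pairs -/

/-- The pencil `L` is positive semidefinite on `C`. -/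
def MonicPencil.IsNonnegOn (L : MonicPencil g ℓ) (C : NCSet g) : Prop :=
  ∀ n, ∀ X ∈ C n, ∀ U, 0 ≤ L.quadForm X U

/-- A boundary point of `C` together with a kernel vector of the polynomial `p` there. -/
structure IsBoundaryPair (C : NCSet g) (p : MatPoly g δ) (X : SymTuple g n)
    (v : Fin δ → Fin n → ℝ) : Prop where
  smul_mem : ∀ t ∈ Set.Ico (0 : ℝ) 1, t • X ∈ C n
  ne_zero : v ≠ 0
  rowEval_eq_zero : ∀ i, rowEval X v (p i) = 0

theorem IsBoundaryPair.directSum {C : NCSet g} (hC : IsOpenMatrixConvex C) {p : MatPoly g δ}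
    {X : SymTuple g m} {v : Fin δ → Fin m → ℝ} (hX : IsBoundaryPair C p X v)
    {Y : SymTuple g n} {w : Fin δ → Fin n → ℝ} (hY : IsBoundaryPair C p Y w) :
    IsBoundaryPair C p (directSum X Y) fun i => Fin.append (v i) (w i) where
  smul_mem t ht := by
    convert hC.directSum_mem m n _ (hX.smul_mem t ht) _ (hY.smul_mem t ht) using 1
    ext j a b
    refine Fin.addCases (fun a => ?_) (fun a => ?_) a <;>
      refine Fin.addCases (fun b => ?_) (fun b => ?_) b <;> simp [FreeConvex.directSum]
  ne_zero := append_family_ne_zero (.inl hX.ne_zero)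
  rowEval_eq_zero i := by
    rw [rowEval_directSum, hX.rowEval_eq_zero, hY.rowEval_eq_zero, append_eq_zero]
    exact ⟨rfl, rfl⟩

theorem MonicPencil.IsNonnegOn.quadForm_nonneg {L : MonicPencil g ℓ} {C : NCSet g}
    (hL : L.IsNonnegOn C) {X : SymTuple g n} (hX : ∀ t ∈ Set.Ico (0 : ℝ) 1, t • X ∈ C n)
    (U : Matrix (Fin n) (Fin ℓ) ℝ) : 0 ≤ L.quadForm X U := by
  by_contra! hneg
  have hs := sqNorm_nonneg U
  have key : ∀ t ∈ Set.Ico (0 : ℝ) 1, 0 ≤ sqNorm U + t * L.linForm X U := by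
    intro t ht
    rw [← L.linForm_smul]
    exact hL n _ (hX t ht) U
  rw [MonicPencil.quadForm] at hneg
  have hl : 0 < -L.linForm X U := by linarith
  -- With `s = sqNorm U` and `l = L.linForm X U`, this `t` is the midpoint of `s / |l|` and `1`, so
  -- `s + t l < 0`.
  have := key ((sqNorm U - L.linForm X U) / (2 * -L.linForm X U))
    ⟨div_nonneg (by linarith) (by linarith), by rw [div_lt_one (by linarith)]; linarith⟩
  have h2 : (sqNorm U - L.linForm X U) / (2 * -L.linForm X U) * L.linForm X U =
      -(sqNorm U - L.linForm X U) / 2 := by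
    have hl0 : L.linForm X U ≠ 0 := (neg_pos.1 hl).ne
    field_simp
  rw [h2] at this
  linarith

/-- At a boundary pair `(X, v)` there is a pencil which is singular at `X`, with a kernel vector
given by polynomials of bounded degree acting on `v`. -/
theorem IsBoundaryPair.exists_pencil {C : NCSet g} (hC : IsOpenMatrixConvex C)
    {p : MatPoly g δ} (hp : ∀ n, ∀ X ∈ C n, IsUnit (p.eval X)) (hd : ∀ i, p i ∈ rowSpan g δ d)
    {X : SymTuple g n} {v : Fin δ → Fin n → ℝ} (hX : IsBoundaryPair C p X v) :
    ∃ ℓ, 0 < ℓ ∧ ∃ L : MonicPencil g ℓ, L.IsNonnegOn C ∧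
      ∃ q : Fin ℓ → Fin δ → FreeAlgebra ℝ (Fin g), (∀ i, q i ∈ rowSpan g δ d) ∧
        (∃ i, rowEval X v (q i) ≠ 0) ∧
        L.act X (Matrix.of fun a i => rowEval X v (q i) a) = 0 := by
  obtain ⟨r, F, hFF, hfix, hmem⟩ := exists_isometry_onto ((rowSpan g δ d).map (rowEval X v))
  have hnot : conj F X ∉ C r := by
    intro hin
    refine (p.not_isUnit_eval_iff (conj F X)).2 ⟨fun i => Fᵀ *ᵥ v i, fun h0 => ?_, fun i => ?_⟩
      (hp r _ hin)
    · refine hX.ne_zero (funext fun i => ?_)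
      have hvi : v i ∈ (rowSpan g δ d).map (rowEval X v) := by
        refine ⟨Pi.single i 1, mem_rowSpan.2 fun j => ?_, rowEval_single_one X v i⟩
        rcases eq_or_ne j i with rfl | hj
        · simpa using one_mem_affineSpan_pow d
        · simp [Pi.single_eq_of_ne hj]
      rw [← hfix _ hvi, show Fᵀ *ᵥ v i = 0 from congrFun h0 i, Matrix.mulVec_zero]
      rfl
    · rw [rowEval_conj hfix (hd i), hX.rowEval_eq_zero, Matrix.mulVec_zero]
  obtain ⟨L, hL, U, hU, hLU⟩ := hC.exists_separating_pencil hnot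
  have hcol : ∀ i, ∃ q ∈ rowSpan g δ d, rowEval X v q = (F * U).col i := fun i => hmem (U.col i)
  choose q hq hqU using hcol
  have hW : (Matrix.of fun a i => rowEval X v (q i) a) = F * U := by
    ext a i
    exact congrFun (hqU i) a
  have hr : 0 < r := by
    refine Nat.pos_of_ne_zero ?_
    rintro rfl
    exact hU (Subsingleton.elim _ _)
  refine ⟨r, hr, L, hL, q, hq, ?_, ?_⟩
  · by_contra! h0
    have hFU : F * U = 0 := by
      rw [← hW]
      ext a i
      exact congrFun (h0 i) a
    refine hU ?_
    rw [← Matrix.one_mul U, ← hFF, Matrix.mul_assoc, hFU, Matrix.mul_zero]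
  · rw [hW]
    have hnn : ∀ U, 0 ≤ L.quadForm X U :=
      MonicPencil.IsNonnegOn.quadForm_nonneg (C := C) hL hX.smul_mem
    refine L.act_eq_zero_of_quadForm hnn ?_
    -- As `F` is an isometry, the form at `X` on `F * U` equals the form at the compression on `U`,
    -- which is zero.
    rw [MonicPencil.quadForm, ← L.linForm_conj, ← hLU, MonicPencil.quadForm, sqNorm, sqNorm,
      Matrix.transpose_mul, Matrix.mul_assoc, ← Matrix.mul_assoc Fᵀ, hFF, Matrix.one_mul]

/-- The rows of the polynomial `L q`. -/
noncomputable def MonicPencil.mulRow (L : MonicPencil g ℓ)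
    (q : Fin ℓ → Fin δ → FreeAlgebra ℝ (Fin g)) (k : Fin ℓ) : Fin δ → FreeAlgebra ℝ (Fin g) :=
  q k + ∑ j, ∑ i, (L.coeff j : Matrix (Fin ℓ) (Fin ℓ) ℝ) i k •
    fun c => FreeAlgebra.ι ℝ j * q i c

theorem MonicPencil.mulRow_mem (L : MonicPencil g ℓ) {q : Fin ℓ → Fin δ → FreeAlgebra ℝ (Fin g)}
    (hq : ∀ i, q i ∈ rowSpan g δ d) (k : Fin ℓ) : L.mulRow q k ∈ rowSpan g δ (d + 1) := by
  refine add_mem (rowSpan_mono (Nat.le_succ d) (hq k)) (Submodule.sum_mem _ fun j _ =>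
    Submodule.sum_mem _ fun i _ => Submodule.smul_mem _ _ (mem_rowSpan.2 fun c => ?_))
  rw [pow_succ']
  exact Submodule.mul_mem_mul (ι_mem_affineSpan j) (mem_rowSpan.1 (hq i) c)

theorem MonicPencil.act_rowEval (L : MonicPencil g ℓ) (X : SymTuple g n) (v : Fin δ → Fin n → ℝ)
    (q : Fin ℓ → Fin δ → FreeAlgebra ℝ (Fin g)) :
    L.act X (Matrix.of fun a i => rowEval X v (q i) a) =
      Matrix.of fun a k => rowEval X v (L.mulRow q k) a := by
  ext a k
  simp only [MonicPencil.act, MonicPencil.mulRow, Matrix.add_apply, Matrix.sum_apply,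
    Matrix.of_apply, map_add, map_sum, map_smul, Pi.add_apply, Finset.sum_apply, Pi.smul_apply,
    smul_eq_mul]
  congr 1
  refine Finset.sum_congr rfl fun j _ => ?_
  rw [Matrix.mul_apply]
  refine Finset.sum_congr rfl fun i _ => ?_
  rw [rowEval_mul, evalHom_ι, mul_comm]
  rfl

/-! ### Direct sums of pencils -/

/-- Coefficients and variables enter `A ⊗ X` symmetrically, so facts about direct sums of points
carry over to direct sums of pencils. -/
theorem MonicPencil.quadForm_swap (L : MonicPencil g ℓ) (X : SymTuple g n)
    (U : Matrix (Fin n) (Fin ℓ) ℝ) :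
    L.quadForm X U = MonicPencil.quadForm (⟨X⟩ : MonicPencil g n) L.coeff Uᵀ := by
  unfold MonicPencil.quadForm MonicPencil.linForm sqNorm
  congr 1
  · rw [Matrix.trace_mul_comm, Matrix.transpose_transpose]
  · refine Finset.sum_congr rfl fun j _ => ?_
    rw [Matrix.transpose_transpose, Matrix.mul_assoc Uᵀ, Matrix.mul_assoc Uᵀ,
      Matrix.trace_mul_comm Uᵀ, Matrix.mul_assoc, Matrix.mul_assoc, Matrix.trace_mul_comm]
    simp only [Matrix.mul_assoc]

/-- The direct sum of two pencils. -/
def MonicPencil.directSum (L : MonicPencil g ℓ) (M : MonicPencil g m) : MonicPencil g (ℓ + m) :=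
  ⟨FreeConvex.directSum L.coeff M.coeff⟩

theorem MonicPencil.IsNonnegOn.directSum {C : NCSet g} {L : MonicPencil g ℓ}
    {M : MonicPencil g m} (hL : L.IsNonnegOn C) (hM : M.IsNonnegOn C) :
    (L.directSum M).IsNonnegOn C := by
  intro n X hX U
  obtain ⟨F, G, hFG⟩ := exists_eq_stack Uᵀ
  rw [MonicPencil.quadForm_swap, hFG, MonicPencil.directSum, MonicPencil.quadForm_directSum]
  have h1 := hL n X hX Fᵀ
  have h2 := hM n X hX Gᵀ
  rw [MonicPencil.quadForm_swap, Matrix.transpose_transpose] at h1 h2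
  exact add_nonneg h1 h2

/-- The quadratic form of `L` at `X` is degenerate. -/
def MonicPencil.IsSingularAt (L : MonicPencil g ℓ) (X : SymTuple g n) : Prop :=
  ∃ U, U ≠ 0 ∧ L.quadForm X U = 0

theorem stack_ne_zero {F : Matrix (Fin m) (Fin k) ℝ} {G : Matrix (Fin n) (Fin k) ℝ}
    (h : F ≠ 0 ∨ G ≠ 0) :
    (Matrix.fromRows F G).reindex finSumFinEquiv (Equiv.refl _) ≠ 0 := by
  intro h0
  refine h.elim (fun hF => hF ?_) fun hG => hG ?_
  · ext a b
    simpa using congrFun (congrFun h0 (Fin.castAdd n a)) b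
  · ext a b
    simpa using congrFun (congrFun h0 (Fin.natAdd m a)) b

theorem MonicPencil.quadForm_zero (L : MonicPencil g ℓ) (X : SymTuple g n) :
    L.quadForm X 0 = 0 := by
  simp [MonicPencil.quadForm, sqNorm, MonicPencil.linForm]

theorem MonicPencil.isSingularAt_directSum {L : MonicPencil g ℓ} {M : MonicPencil g m}
    {X : SymTuple g n} (h : L.IsSingularAt X ∨ M.IsSingularAt X) :
    (L.directSum M).IsSingularAt X := by
  rcases h with ⟨U, hU, h0⟩ | ⟨U, hU, h0⟩
  · refine ⟨((Matrix.fromRows Uᵀ (0 : Matrix (Fin m) (Fin n) ℝ)).reindex finSumFinEquiv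
      (Equiv.refl _))ᵀ, fun h => ?_, ?_⟩
    · exact stack_ne_zero (.inl fun h' => hU (Matrix.transpose_eq_zero.1 h'))
        (Matrix.transpose_eq_zero.1 h)
    · rw [MonicPencil.quadForm_swap, Matrix.transpose_transpose, MonicPencil.directSum,
        MonicPencil.quadForm_directSum, ← MonicPencil.quadForm_swap, h0,
        MonicPencil.quadForm_zero, add_zero]
  · refine ⟨((Matrix.fromRows (0 : Matrix (Fin ℓ) (Fin n) ℝ) Uᵀ).reindex finSumFinEquiv
      (Equiv.refl _))ᵀ, fun h => ?_, ?_⟩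
    · exact stack_ne_zero (.inr fun h' => hU (Matrix.transpose_eq_zero.1 h'))
        (Matrix.transpose_eq_zero.1 h)
    · rw [MonicPencil.quadForm_swap, Matrix.transpose_transpose, MonicPencil.directSum,
        MonicPencil.quadForm_directSum, ← MonicPencil.quadForm_swap, h0,
        MonicPencil.quadForm_zero, zero_add]

/-! ### One pencil for all boundary pairs -/

/-- The rows of degree at most `d` which annihilate `v` at `X`. -/
noncomputable def annihilator (d : ℕ) (X : SymTuple g n) (v : Fin δ → Fin n → ℝ) :
    Submodule ℝ (rowSpan g δ d) :=
  LinearMap.ker ((rowEval X v).domRestrict (rowSpan g δ d))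

theorem mem_annihilator {X : SymTuple g n} {v : Fin δ → Fin n → ℝ} {q : rowSpan g δ d} :
    q ∈ annihilator d X v ↔ rowEval X v q = 0 := Iff.rfl

theorem annihilator_directSum (X : SymTuple g m) (Y : SymTuple g n) (v : Fin δ → Fin m → ℝ)
    (w : Fin δ → Fin n → ℝ) :
    annihilator d (directSum X Y) (fun i => Fin.append (v i) (w i)) =
      annihilator d X v ⊓ annihilator d Y w := by
  ext q
  rw [Submodule.mem_inf, mem_annihilator, mem_annihilator, mem_annihilator, rowEval_directSum,
    append_eq_zero]

/-- Among the boundary pairs annihilated by `I` there is one whose annihilator is the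
smallest. -/
theorem exists_dominating {C : NCSet g} (hC : IsOpenMatrixConvex C) {p : MatPoly g δ}
    {I : Submodule ℝ (rowSpan g δ d)}
    (hI : ∃ n, ∃ X : SymTuple g n, ∃ v, IsBoundaryPair C p X v ∧ I ≤ annihilator d X v) :
    ∃ n, ∃ X : SymTuple g n, ∃ v, IsBoundaryPair C p X v ∧ I ≤ annihilator d X v ∧
      ∀ m, ∀ Y : SymTuple g m, ∀ w, IsBoundaryPair C p Y w → I ≤ annihilator d Y w →
        annihilator d X v ≤ annihilator d Y w := by
  set S : Set (Submodule ℝ (rowSpan g δ d)) := {J | ∃ n, ∃ X : SymTuple g n, ∃ v,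
    IsBoundaryPair C p X v ∧ I ≤ annihilator d X v ∧ J = annihilator d X v}
  have hS : S.Nonempty := by
    obtain ⟨n, X, v, h1, h2⟩ := hI
    exact ⟨_, n, X, v, h1, h2, rfl⟩
  obtain ⟨J, ⟨n, X, v, h1, h2, rfl⟩, hmin⟩ := WellFounded.has_min
    (wellFounded_lt : WellFounded fun J K : Submodule ℝ (rowSpan g δ d) => J < K) S hS
  refine ⟨n, X, v, h1, h2, fun m Y w hY hIY => ?_⟩
  -- The annihilator of a direct sum is the intersection, so a minimal annihilator is a least one.
  have := hmin _ ⟨_, directSum X Y, _, h1.directSum hC hY,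
    by rw [annihilator_directSum]; exact le_inf h2 hIY, rfl⟩
  rw [annihilator_directSum, inf_lt_left, not_not] at this
  exact this

/-- Ascending induction on `I` in a finite-dimensional space. Degree `d + 1` leaves room for the
rows of `L q`, where `q` has degree `d`. -/
theorem exists_pencil_of_annihilator {C : NCSet g} (hC : IsOpenMatrixConvex C)
    {p : MatPoly g δ} (hp : ∀ n, ∀ X ∈ C n, IsUnit (p.eval X)) (hd : ∀ i, p i ∈ rowSpan g δ d)
    (I : Submodule ℝ (rowSpan g δ (d + 1))) :
    ∃ ℓ, 0 < ℓ ∧ ∃ L : MonicPencil g ℓ, L.IsNonnegOn C ∧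
      ∀ n, ∀ X : SymTuple g n, ∀ v, IsBoundaryPair C p X v → I ≤ annihilator (d + 1) X v →
        L.IsSingularAt X := by
  induction I using WellFoundedGT.induction with
  | ind I ih =>
  by_cases hI : ∃ n, ∃ X : SymTuple g n, ∃ v, IsBoundaryPair C p X v ∧ I ≤ annihilator (d + 1) X v
  · obtain ⟨n, X, v, hX, hIX, hdom⟩ := exists_dominating hC hI
    obtain ⟨ℓ, hℓ, L, hL, q, hq, ⟨i, hi⟩, hact⟩ := hX.exists_pencil hC hp hd
    set q' : Fin ℓ → rowSpan g δ (d + 1) := fun i => ⟨q i, rowSpan_mono (Nat.le_succ d) (hq i)⟩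
    have hlt : I < I ⊔ Submodule.span ℝ (Set.range q') := by
      refine left_lt_sup.2 fun hle => hi ?_
      exact hIX (hle (Submodule.subset_span ⟨i, rfl⟩))
    obtain ⟨ℓ', -, L', hL', hsing⟩ := ih _ hlt
    refine ⟨ℓ + ℓ', by omega, L.directSum L', hL.directSum hL', fun m Y w hY hIY => ?_⟩
    refine MonicPencil.isSingularAt_directSum ?_
    by_cases hall : ∀ i, rowEval Y w (q i) = 0
    · refine .inr (hsing m Y w hY (sup_le hIY (Submodule.span_le.2 ?_)))
      rintro _ ⟨i, rfl⟩
      exact hall i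
    · refine .inl ⟨Matrix.of fun a i => rowEval Y w (q i) a, fun h0 => hall fun i => ?_, ?_⟩
      · ext a
        exact congrFun (congrFun h0 a) i
      · refine L.quadForm_eq_zero_of_act ?_
        rw [L.act_rowEval] at hact ⊢
        have hk : ∀ k, rowEval Y w (L.mulRow q k) = 0 := by
          intro k
          refine hdom m Y w hY hIY (x := ⟨L.mulRow q k, L.mulRow_mem hq k⟩) ?_
          ext a
          exact congrFun (congrFun hact a) k
        ext a k
        exact congrFun (hk k) a
  -- No boundary pair satisfies the relations, so the constant pencil `1` serves.
  · refine ⟨1, one_pos, ⟨0⟩, fun n X _ U => ?_, fun n X v hX hIX => (hI ⟨n, X, v, hX, hIX⟩).elim⟩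
    have : MonicPencil.linForm (⟨0⟩ : MonicPencil g 1) X U = 0 := by
      simp [MonicPencil.linForm]
    rw [MonicPencil.quadForm, this, add_zero]
    exact sqNorm_nonneg U

/-! ### Convex semi-algebraic sets are positivity sets -/

theorem continuous_evalHom (q : FreeAlgebra ℝ (Fin g)) :
    Continuous fun X : SymTuple g n => evalHom X q := by
  induction q using FreeAlgebra.induction with
  | grade0 r =>
    simp only [AlgHom.commutes]
    exact continuous_const
  | grade1 j =>
    simp only [evalHom_ι]
    exact continuous_subtype_val.comp (continuous_apply j)
  | mul a b ha hb =>
    simp only [map_mul]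
    exact ha.matrix_mul hb
  | add a b ha hb =>
    simp only [map_add]
    exact ha.add hb

theorem MatPoly.isOpen_invertibleAt (p : MatPoly g δ) (n : ℕ) : IsOpen (invertibleAt p n) := by
  have hcont : Continuous fun X : SymTuple g n => p.eval X :=
    continuous_matrix fun a b => (continuous_evalHom (p a.1 b.1)).matrix_elem a.2 b.2
  have : invertibleAt p n = (fun X : SymTuple g n => (p.eval X).det) ⁻¹' {0}ᶜ := by
    ext X
    rw [mem_invertibleAt, Matrix.isUnit_iff_isUnit_det, isUnit_iff_ne_zero]
    rfl
  rw [this]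
  exact isOpen_compl_singleton.preimage hcont.matrix_det

/-- Since `C n` is open, `X` lies strictly between `0`, where the form is positive definite, and a
further point of `C n`. -/
theorem MonicPencil.IsNonnegOn.subset_positivitySet {L : MonicPencil g ℓ} {C : NCSet g}
    (hL : L.IsNonnegOn C) (hC : IsOpenMatrixConvex C) (n : ℕ) : C n ⊆ L.positivitySet n := by
  intro X hX
  refine L.mem_positivitySet.2 fun U hU => ?_
  have hcont : Continuous fun t : ℝ => (1 + t) • X := by fun_prop
  obtain ⟨ε, hε, h⟩ := Metric.isOpen_iff.1 ((hC.isOpen n).preimage hcont) 0 (by simpa using hX)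
  have hmem : (1 + ε / 2) • X ∈ C n := h (by
    rw [Metric.mem_ball, dist_zero_right, Real.norm_of_nonneg (by positivity)]
    linarith)
  have h1 := hL n _ hmem U
  rw [MonicPencil.quadForm, L.linForm_smul] at h1
  have h2 := mul_pos (half_pos hε) (sqNorm_pos hU)
  have h3 : 0 < (1 + ε / 2) * (sqNorm U + L.linForm X U) := by linarith
  exact (mul_pos_iff_of_pos_left (by positivity)).1 h3

/-- An open matrix convex set which is basic open semi-algebraic is the solution set of a
linear matrix inequality. -/
theorem IsOpenMatrixConvex.exists_eq_positivitySet {C : NCSet g} (hC : IsOpenMatrixConvex C)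
    (hs : IsNCBasicOpenSemialgebraic C) :
    ∃ ℓ : ℕ, 0 < ℓ ∧ ∃ L : MonicPencil g ℓ, C = L.positivitySet := by
  obtain ⟨δ, -, p, -, -, hCp⟩ := hs
  have hp : ∀ n, ∀ X ∈ C n, IsUnit (p.eval X) := by
    intro n X hX
    rw [hCp] at hX
    exact isUnit_eval_of_mem_invertibilitySet hX
  have hseg : ∀ {n : ℕ} {X : SymTuple g n},
      (∀ t ∈ Set.Icc (0 : ℝ) 1, IsUnit (p.eval (t • X))) → X ∈ C n := by
    intro n X hX
    rw [hCp]
    exact mem_invertibilitySet_of_segment hX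
  obtain ⟨d, hd⟩ := exists_mem_rowSpan p
  obtain ⟨ℓ, hℓ, L, hL, hsing⟩ := exists_pencil_of_annihilator hC hp hd ⊥
  refine ⟨ℓ, hℓ, L, funext fun n => (hL.subset_positivitySet hC n).antisymm fun X hX => ?_⟩
  by_contra hXC
  set S : Set ℝ := Set.Icc 0 1 ∩ {t | ¬ IsUnit (p.eval (t • X))}
  have hcont : Continuous fun t : ℝ => t • X := by fun_prop
  have hSc : IsCompact S :=
    isCompact_Icc.inter_right ((p.isOpen_invertibleAt n).preimage hcont).isClosed_compl
  have hSne : S.Nonempty := by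
    by_contra hempty
    refine hXC (hseg fun t ht => ?_)
    by_contra hu
    exact hempty ⟨t, ht, hu⟩
  -- The first singular point of `p` on the ray towards `X` gives a boundary pair, yet it still lies
  -- in the convex positivity set of `L`.
  obtain ⟨t, ⟨ht, htu⟩, hleast⟩ := hSc.exists_isLeast hSne
  obtain ⟨v, hv, hv0⟩ := (p.not_isUnit_eval_iff _).1 htu
  have hpair : IsBoundaryPair C p (t • X) v := by
    refine ⟨fun s hs => hseg fun r hr => ?_, hv, hv0⟩
    by_contra hu
    rw [smul_smul, smul_smul] at hu
    have hrs : r * s < 1 := (mul_le_of_le_one_left hs.1 hr.2).trans_lt hs.2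
    have hrs0 : 0 ≤ r * s := mul_nonneg hr.1 hs.1
    have hle : r * s * t ≤ t := mul_le_of_le_one_left ht.1 hrs.le
    have := hleast ⟨⟨mul_nonneg hrs0 ht.1,
      hle.trans ht.2⟩, hu⟩
    have heq : r * s * t = t := le_antisymm hle this
    have ht0 : t = 0 := by
      have : (1 - r * s) * t = 0 := by linarith
      exact (mul_eq_zero.1 this).resolve_left (by linarith)
    refine htu ?_
    rw [ht0, zero_smul]
    exact hp n 0 (hC.zero_mem n)
  obtain ⟨U, hU, h0⟩ := hsing n _ v hpair bot_le
  have hmem : t • X ∈ L.positivitySet n := by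
    have := L.isOpenMatrixConvex.convex n (L.isOpenMatrixConvex.zero_mem n) hX
      (sub_nonneg.2 ht.2) ht.1 (sub_add_cancel 1 t)
    simpa using this
  exact (L.mem_positivitySet.1 hmem U hU).ne' h0

end FreeConvex

theorem proposition1p6 {g h ℓ' : ℕ} (L' : FreeConvex.MonicPencil (g + h) ℓ') :
    FreeConvex.IsOpenMatrixConvex (FreeConvex.proj L'.positivitySet) ∧
    (FreeConvex.IsNormBounded (FreeConvex.proj L'.positivitySet) →
      ((∃ ℓ : ℕ, 0 < ℓ ∧ ∃ L : FreeConvex.MonicPencil g ℓ,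
            FreeConvex.proj L'.positivitySet = L.positivitySet) ∨
        ¬ FreeConvex.IsNCOpenSemialgebraic (FreeConvex.proj L'.positivitySet)) ∧
      ¬ ((∃ ℓ : ℕ, 0 < ℓ ∧ ∃ L : FreeConvex.MonicPencil g ℓ,
            FreeConvex.proj L'.positivitySet = L.positivitySet) ∧
        ¬ FreeConvex.IsNCOpenSemialgebraic (FreeConvex.proj L'.positivitySet))) := by
  have hC := L'.isOpenMatrixConvex.proj
  refine ⟨hC, fun _ => ⟨?_, ?_⟩⟩
  · refine or_iff_not_imp_right.2 fun hs => ?_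
    exact hC.exists_eq_positivitySet (hC.isNCBasicOpenSemialgebraic (not_not.1 hs))
  · rintro ⟨⟨ℓ, hℓ, L, hL⟩, hs⟩
    rw [hL] at hs
    exact hs (L.isNCOpenSemialgebraic hℓ)
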